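/- **Setting.** Let $\mathcal X$ be a set and $\mathcal C$ a collection of subsets of $\mathcal X$ (groups), identified with their indicator functions $c:\mathcal X\to\{0,1\}$, such that every $x\in\mathcal X$ lies in at most $m$ groups: $|\{c\in\mathcal C: c(x)=1\}|\le m$. Define on $\mathbb R\times\mathcal X$ the kernel $$k_{\mathrm{MC}}\big((p,x),(p',x')\big)=e^{-|p-p'|}\cdot\big|\{c\in\mathcal C: c(x)=c(x')=1\}\big| .$$ **The Any Kernel algorithm** with a kernel $k$ on $\mathcal X\times[0,1]$. In round $t=1,2,\dots$ it has the history $(x_i,p_i,y_i)_{i<t}$, receives $x_t\in\mathcal X$ and forms $$S_t(p)=\sum_{i=1}^{t-1}k\big((x_t,p),(x_i,p_i)\big)(y_i-p_i)+\tfrac12\,k\big((x_t,p),(x_t,p)\big)(1-2p),\qquad p\in[0,1].$$ It returns a distribution $\Delta_t$ on $[0,1]$ as follows. 1. If $\operatorname{sign}S_t(0)=\operatorname{sign}S_t(1)\ne0$, then $\Delta_t$ is the point mass at $\tfrac12(1+\operatorname{sign}S_t(0))$. 2. Otherwise let $\epsilon_t=1/(10t^3B_t)$ with $B_t=\max_{t'\le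 t}k\big((x_{t'},p_{t'}),(x_{t'},p_{t'})\big)$, where the points that the search considers take the place of $p_t$, and $\epsilon_t=\infty$ if $B_t=0$. * If $k$ is continuous in the forecasts, $\Delta_t$ is the point mass at any $p\in[0,1]$ with $|S_t(p)|\le\epsilon_t$ (found by a search). * If not, the algorithm finds $q,q'\in[0,1]$ with $|q-q'|\le\epsilon_t$, $\operatorname{sign}S_t(q)=\operatorname{sign}S_t(0)$ and $\operatorname{sign}S_t(q')=\operatorname{sign}S_t(1)$, and $\Delta_t$ gives mass $\tau$ to $q$ and $1-\tau$ to $q'$, where $\tau\in[0,1]$ and $\tau\,(|S_t(q)|+|S_t(q')|)=|S_t(q')|$. Then $p_t$ is drawn from $\Delta_t$ and an outcome $y_t\in\{0,1\}$ is revealed. Features and outcomes are arbitrary; they may be chosen adversarially, with knowledge of the history and of $\Delta_t$. **Distance to online multicalibration.** For $c\in\mathcal C$ let $\mathrm{PC}(c)$ be the set of sequences $\bm q\in[0,1]^T$ such that $\sum_{t=1}^T(y_t-v)\,c(x_t)\,\mathbf 1[q_t=v]=0$ for all $v\in[0,1]$, and let $$\mathrm{dMCE}_{\bm y,\mathcal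 C}(\bm p)=\sup_{c\in\mathcal C}\ \inf_{\bm q\in\mathrm{PC}(c)}\ \sum_{t=1}^T|p_t-q_t| ,$$ where the supremum over an empty $\mathcal C$ is $0$. **Theorem.** There is an absolute constant $K>0$ such that for all $\mathcal X$, $\mathcal C$ and $m$ as above, the kernel satisfies $|k_{\mathrm{MC}}|\le m$ everywhere, and for every $T$, every transcript $(x_t,p_t,y_t)_{t=1}^T$ of the Any Kernel algorithm run with the kernel $k_{\mathrm{MC}}$ satisfies $$\mathrm{dMCE}_{\bm y,\mathcal C}(\bm p)\le K\sqrt{mT}.$$ -/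

import Mathlib

namespace AnyKernel

/-- The step-1 function `S_t` of the Any Kernel algorithm, for a kernel `k` on `𝒳 × [0,1]`.
Rounds are indexed by `Fin T` (so `t : Fin T` is the round number `t + 1`); only `x t` and the
history of the rounds before `t` enter. -/
noncomputable def S {X : Type*} (k : X × unitInterval → X × unitInterval → ℝ) {T : ℕ}
    (x : Fin T → X) (p : Fin T → unitInterval) (y : Fin T → ℝ) (t : Fin T) (r : unitInterval) : ℝ :=
  (∑ i ∈ Finset.Iio t, k (x t, r) (x i, p i) * (y i - (p i : ℝ)))
    + 1 / 2 * k (x t, r) (x t, r) * (1 - 2 * (r : ℝ))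

/-- `B_t = max_{t' ≤ t} k((x_{t'}, p_{t'}), (x_{t'}, p_{t'}))`, where the prediction of round `t`
itself is the candidate `r`. -/
noncomputable def B {X : Type*} (k : X × unitInterval → X × unitInterval → ℝ) {T : ℕ}
    (x : Fin T → X) (p : Fin T → unitInterval) (t : Fin T) (r : unitInterval) : ℝ :=
  (Finset.Iic t).sup' ⟨t, Finset.mem_Iic.mpr le_rfl⟩
    (fun i => k (x i, Function.update p t r i) (x i, Function.update p t r i))

/-- `d ≤ ε_t`, where `ε_t = 1 / (10 t³ B_t)` and the round number is `t + 1`. Written without a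
division, so that `B_t = 0` reads as `ε_t = ∞`. -/
def WithinTolerance {X : Type*} (k : X × unitInterval → X × unitInterval → ℝ) {T : ℕ}
    (x : Fin T → X) (p : Fin T → unitInterval) (t : Fin T) (r : unitInterval) (d : ℝ) : Prop :=
  d * (10 * ((t : ℝ) + 1) ^ 3 * B k x p t r) ≤ 1

/-- The kernel is continuous in the forecasts. -/
def ForecastContinuous {X : Type*} (k : X × unitInterval → X × unitInterval → ℝ) : Prop :=
  ∀ x x' : X, Continuous fun r : unitInterval × unitInterval => k (x, r.1) (x', r.2)

/-- `Δ` is a distribution that the Any Kernel algorithm, run on the kernel `k`, may return in round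
`t`. The searches may end at any point(s) meeting their stopping criterion, hence a relation. -/
def IsRoundOutput {X : Type*} (k : X × unitInterval → X × unitInterval → ℝ) {T : ℕ}
    (x : Fin T → X) (p : Fin T → unitInterval) (y : Fin T → ℝ) (t : Fin T)
    (Δ : MeasureTheory.Measure unitInterval) : Prop :=
  let s : unitInterval → SignType := fun r => SignType.sign (S k x p y t r)
  -- both ends have the same nonzero sign
  ((s 0 = s 1 ∧ s 0 ≠ 0) ∧
    ∃ r : unitInterval, (r : ℝ) = 1 / 2 * (1 + ((s 0 : SignType) : ℝ)) ∧
      Δ = MeasureTheory.Measure.dirac r) ∨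
  -- otherwise, continuous kernel: an approximate zero of `S_t`
  (¬ (s 0 = s 1 ∧ s 0 ≠ 0) ∧ ForecastContinuous k ∧
    ∃ r : unitInterval, WithinTolerance k x p t r |S k x p y t r| ∧
      Δ = MeasureTheory.Measure.dirac r) ∨
  -- otherwise, discontinuous kernel: `q` with probability `τ`, and `q'` with probability `1 - τ`
  (¬ (s 0 = s 1 ∧ s 0 ≠ 0) ∧ ¬ ForecastContinuous k ∧
    ∃ q q' : unitInterval,
      WithinTolerance k x p t q |(q' : ℝ) - q| ∧ WithinTolerance k x p t q' |(q' : ℝ) - q| ∧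
      s q = s 0 ∧ s q' = s 1 ∧
      ∃ τ : unitInterval,
        (τ : ℝ) * (|S k x p y t q| + |S k x p y t q'|) = |S k x p y t q'| ∧
        Δ = ProbabilityTheory.bernoulliMeasure q q' τ)

/-- `{(x_t, p_t, y_t)}` is a possible transcript of `T` rounds of the Any Kernel algorithm run on
`k`: the outcomes are binary, and each `p_t` is a possible draw from (a point of positive mass of)
the finitely supported distribution `Δ_t` returned by the algorithm in round `t`. Features and
outcomes are otherwise arbitrary; in particular they may have been chosen by an adversary who sees
the history and `Δ_t`. -/
def IsTranscript {X : Type*} (k : X × unitInterval → X × unitInterval → ℝ) {T : ℕ}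
    (x : Fin T → X) (p : Fin T → unitInterval) (y : Fin T → ℝ) : Prop :=
  ∀ t : Fin T, (y t = 0 ∨ y t = 1) ∧
    ∃ Δ : MeasureTheory.Measure unitInterval, IsRoundOutput k x p y t Δ ∧ Δ {p t} ≠ 0

/-- The Laplace kernel on `ℝ`. -/
noncomputable def kLap (r r' : ℝ) : ℝ := Real.exp (-|r - r'|)

/-- The intersection kernel of a collection of groups, a group being the set on which its indicator
function equals `1`. -/
noncomputable def intersectionKernel {X : Type*} (C : Set (Set X)) (x x' : X) : ℝ :=
  ({c ∈ C | x ∈ c ∧ x' ∈ c}.ncard : ℝ)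

/-- The product kernel `k_MC` on `ℝ × 𝒳`. -/
noncomputable def kMC {X : Type*} (C : Set (Set X)) (z z' : ℝ × X) : ℝ :=
  kLap z.1 z'.1 * intersectionKernel C z.2 z'.2

/-- `k_MC` as a kernel on `𝒳 × [0,1]`, the input format of the algorithm. -/
noncomputable def kMCUnit {X : Type*} (C : Set (Set X)) (z z' : X × unitInterval) : ℝ :=
  kMC C ((z.2 : ℝ), z.1) ((z'.2 : ℝ), z'.1)

/-- `PC(c)`: the prediction sequences that are perfectly calibrated on the group `c`. -/
def PC {X : Type*} {T : ℕ} (x : Fin T → X) (y : Fin T → ℝ) (c : Set X) :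
    Set (Fin T → unitInterval) :=
  {q | ∀ v : unitInterval,
    ∑ t, (y t - (v : ℝ)) * c.indicator (fun _ => (1 : ℝ)) (x t)
      * ({v} : Set unitInterval).indicator (fun _ => (1 : ℝ)) (q t) = 0}

/-- The distance to online multicalibration
`dMCE_{y,C}(p) = sup_{c ∈ C} inf_{q ∈ PC(c)} ∑_t |p_t - q_t|`, as an extended nonnegative real. -/
noncomputable def dMCE {X : Type*} {T : ℕ} (x : Fin T → X) (y : Fin T → ℝ) (C : Set (Set X))
    (p : Fin T → unitInterval) : ENNReal :=
  ⨆ c ∈ C, ⨅ q ∈ PC x y c, ∑ t, ENNReal.ofReal |(p t : ℝ) - (q t : ℝ)|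

end AnyKernel

open Finset

/-! ### Energy of the residual along a transcript, and on a single group -/

namespace AnyKernel

/-! The energy `∑ t, ∑ s, k(z_t, z_s) (y_t - p_t) (y_s - p_s)` is a sum of increments over rounds.
The increment of round `t` is `2 (y_t - p_t) S_t(p_t)` plus a variance term, and the choice of `p_t`
makes the product small or nonpositive whatever `y_t` is; so the energy is at most `N = m T`
(`IsTranscript.sum_sum_le`). The intersection kernel is a sum over groups and the Laplace kernel is
positive semidefinite on `[0,1]`, so the Laplace energy of each single group is at most `N`
(`energy_group_le`). It remains to show, for one group, that energy `N` forces distance `O(√N)` to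
calibration (`exists_calibrated_of_energy_le`).

The energy controls the `L²` norm, hence the `L¹` norm, of the cumulative function `Γ` of the
residuals weighted by `exp p` (`energy_eq`, `integral_abs_cumulative_le`). Away from `p = 1`,
summation by parts changes the weight to `1 / (1 - p)`. In this weight a one counts `1` and a zero
at `p` counts `-p / (1 - p)`, minus the number of ones it needs beside it for calibration. The
cumulative function is then supply minus demand of ones, and its `L¹` norm is the cost of
transporting the ones monotonically to the zeros. `exists_grid_assignment` does this on a grid of
about `√N` cells; moving whole ones adds an imbalance `O(1)` per cell. Replacing grid labels by cell
averages costs exactly the total imbalance (`exists_calibrated_of_partition`).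

To avoid the pole at `1`, the forecasts are cut at some `θ` in `[1/3, 2/3]` and the upper part is
reflected by `p ↦ 1 - p`, `y ↦ 1 - y`. -/

theorem sum_sum_mul_mul_eq_sum {T : ℕ} (κ : Fin T → Fin T → ℝ) (hκ : ∀ s t, κ s t = κ t s)
    (w : Fin T → ℝ) :
    ∑ t, ∑ s, κ t s * w t * w s =
      ∑ t, (2 * w t * ∑ i ∈ Finset.Iio t, κ t i * w i + κ t t * w t ^ 2) := by
  have h1 : ∀ t s : Fin T, κ t s * w t * w s = (if s < t then κ t s * w t * w s else 0) +
      (if t < s then κ s t * w s * w t else 0) + if s = t then κ t t * w t ^ 2 else 0 := by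
    intro t s
    rcases lt_trichotomy s t with h | h | h
    · simp [h, h.not_gt, h.ne]
    · subst h
      simp
      ring
    · rw [if_neg h.not_gt, if_pos h, if_neg h.ne', hκ t s]
      ring
  have h2 : ∀ t, ∑ s, (if s < t then κ t s * w t * w s else 0)
      = w t * ∑ i ∈ Finset.Iio t, κ t i * w i := by
    intro t
    rw [← Finset.sum_filter, Finset.mul_sum]
    refine Finset.sum_congr (by ext; simp) fun i _ => by ring
  have h3 : ∑ t, ∑ s, (if t < s then κ s t * w s * w t else 0)
      = ∑ t, w t * ∑ i ∈ Finset.Iio t, κ t i * w i := by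
    rw [Finset.sum_comm]
    exact Finset.sum_congr rfl fun t _ => h2 t
  refine (Finset.sum_congr rfl fun t _ => Finset.sum_congr rfl fun s _ => h1 t s).trans ?_
  simp only [Finset.sum_add_distrib]
  rw [h3]
  simp_rw [h2]
  rw [← Finset.sum_add_distrib, ← Finset.sum_add_distrib, ← Finset.sum_add_distrib]
  refine Finset.sum_congr rfl fun t _ => ?_
  rw [Finset.sum_ite_eq', if_pos (Finset.mem_univ _)]
  ring

section groups

variable {X : Type*} {C : Set (Set X)} {m : ℕ}

theorem finite_groups (hm : ∀ x : X, {c ∈ C | x ∈ c}.encard ≤ m) (x : X) :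
    {c ∈ C | x ∈ c}.Finite :=
  Set.finite_of_encard_le_coe (hm x)

theorem intersectionKernel_le (hm : ∀ x : X, {c ∈ C | x ∈ c}.encard ≤ m) (x x' : X) :
    intersectionKernel C x x' ≤ m := by
  have h1 : {c ∈ C | x ∈ c ∧ x' ∈ c}.encard ≤ m :=
    (Set.encard_le_encard (t := {c ∈ C | x ∈ c}) fun c hc => ⟨hc.1, hc.2.1⟩).trans (hm x)
  have h2 : {c ∈ C | x ∈ c ∧ x' ∈ c}.ncard ≤ m := ENat.toNat_le_of_le_natCast h1
  unfold intersectionKernel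
  exact_mod_cast h2

theorem intersectionKernel_nonneg (x x' : X) : 0 ≤ intersectionKernel C x x' :=
  Nat.cast_nonneg _

theorem intersectionKernel_comm (x x' : X) :
    intersectionKernel C x x' = intersectionKernel C x' x := by
  simp only [intersectionKernel, and_comm]

theorem intersectionKernel_le_self (hm : ∀ x : X, {c ∈ C | x ∈ c}.encard ≤ m) (x x' : X) :
    intersectionKernel C x x' ≤ intersectionKernel C x x := by
  unfold intersectionKernel
  have hsub : {c ∈ C | x ∈ c ∧ x' ∈ c} ⊆ {c ∈ C | x ∈ c ∧ x ∈ c} :=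
    fun c hc => ⟨hc.1, hc.2.1, hc.2.1⟩
  exact_mod_cast Set.ncard_le_ncard hsub
    ((finite_groups hm x).subset fun c hc => ⟨hc.1, hc.2.1⟩)

theorem abs_kMC_le (hm : ∀ x : X, {c ∈ C | x ∈ c}.encard ≤ m) (z z' : ℝ × X) :
    |kMC C z z'| ≤ m := by
  have h1 : kLap z.1 z'.1 ≤ 1 := Real.exp_le_one_iff.2 (neg_nonpos.2 (abs_nonneg _))
  have h2 : 0 < kLap z.1 z'.1 := Real.exp_pos _
  rw [kMC, abs_mul, abs_of_pos h2, abs_of_nonneg (intersectionKernel_nonneg _ _)]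
  exact (mul_le_of_le_one_left (intersectionKernel_nonneg _ _) h1).trans
    (intersectionKernel_le hm _ _)

theorem kMCUnit_comm (z z' : X × unitInterval) : kMCUnit C z z' = kMCUnit C z' z := by
  simp only [kMCUnit, kMC, kLap, abs_sub_comm (z.2 : ℝ), intersectionKernel_comm z.1]

theorem kMCUnit_self (z : X × unitInterval) :
    kMCUnit C z z = intersectionKernel C z.1 z.1 := by
  simp [kMCUnit, kMC, kLap]

theorem forecastContinuous_kMCUnit : ForecastContinuous (kMCUnit C) := by
  intro x x'
  simp only [kMCUnit, kMC, kLap]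
  fun_prop

/-- One round of the algorithm increases the squared norm of the residual by at most `m`. -/
theorem IsTranscript.round_le (hm : ∀ x : X, {c ∈ C | x ∈ c}.encard ≤ m) {T : ℕ}
    {x : Fin T → X} {p : Fin T → unitInterval} {y : Fin T → ℝ}
    (h : IsTranscript (kMCUnit C) x p y) (t : Fin T) :
    2 * (y t - p t) * ∑ i ∈ Finset.Iio t, kMCUnit C (x t, p t) (x i, p i) * (y i - p i)
      + kMCUnit C (x t, p t) (x t, p t) * (y t - p t) ^ 2 ≤ m := by
  obtain ⟨hy, Δ, hΔ, hpos⟩ := h t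
  set k := kMCUnit C with hk
  have hdirac : ∀ r : unitInterval, Δ = MeasureTheory.Measure.dirac r → p t = r := by
    rintro r rfl
    by_contra hne
    refine hpos ?_
    rw [MeasureTheory.Measure.dirac_apply' _ (measurableSet_singleton _)]
    simp [Ne.symm hne]
  have hp0 := (p t).2.1
  have hp1 := (p t).2.2
  have hself : k (x t, p t) (x t, p t) = intersectionKernel C (x t) (x t) := kMCUnit_self _
  -- The self term of `S` absorbs the dependence on the outcome: for binary `y`, `(y - p)² - (y -
  -- p)(1 - 2p) = p(1 - p)`.
  have hident : 2 * (y t - p t) * ∑ i ∈ Finset.Iio t, k (x t, p t) (x i, p i) * (y i - p i)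
      + k (x t, p t) (x t, p t) * (y t - p t) ^ 2
      = 2 * ((y t - p t) * S k x p y t (p t))
        + intersectionKernel C (x t) (x t) * (p t * (1 - p t)) := by
    rw [S, hself]
    rcases hy with hy | hy <;> rw [hy] <;> ring
  rw [hident]
  have hKm := intersectionKernel_le hm (x t) (x t)
  have hK0 : 0 ≤ intersectionKernel C (x t) (x t) := intersectionKernel_nonneg _ _
  have hvar : (p t : ℝ) * (1 - p t) ≤ 1 / 4 := by nlinarith [sq_nonneg ((p t : ℝ) - 1 / 2)]
  have hvar0 : 0 ≤ (p t : ℝ) * (1 - p t) := mul_nonneg hp0 (by linarith)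
  have hKv : intersectionKernel C (x t) (x t) * (p t * (1 - p t)) ≤ m * (1 / 4) :=
    mul_le_mul hKm hvar hvar0 (Nat.cast_nonneg _)
  have hw0 : y t - p t ≤ 1 := by rcases hy with hy | hy <;> rw [hy] <;> linarith
  have hw1 : -1 ≤ y t - p t := by rcases hy with hy | hy <;> rw [hy] <;> linarith
  have hm0 : (0 : ℝ) ≤ m := Nat.cast_nonneg _
  suffices hS : (y t - p t) * S k x p y t (p t) ≤ m / 10 by linarith
  rcases hΔ with ⟨⟨h01, h0⟩, r, hr, hΔr⟩ | ⟨-, -, r, hr, hΔr⟩ | ⟨-, hnc, -⟩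
  · have hpr := hdirac r hΔr
    beta_reduce at h01 hr
    refine le_trans ?_ (by positivity : (0 : ℝ) ≤ m / 10)
    have hcase : SignType.sign (S k x p y t 0) = 1 ∨ SignType.sign (S k x p y t 0) = -1 := by
      rcases lt_trichotomy (S k x p y t 0) 0 with h2 | h2 | h2
      · exact Or.inr (sign_neg h2)
      · exact absurd (by simp [h2]) h0
      · exact Or.inl (sign_pos h2)
    rcases hcase with hs | hs
    · have hr1 : r = 1 := by
        apply Subtype.ext
        rw [hr, hs]
        norm_num
      have hs1 : 0 < S k x p y t 1 := sign_eq_one_iff.1 (h01.symm.trans hs)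
      rw [hpr, hr1]
      refine mul_nonpos_of_nonpos_of_nonneg ?_ hs1.le
      rcases hy with hy | hy <;> rw [hy] <;> simp
    · have hr0 : r = 0 := by
        apply Subtype.ext
        rw [hr, hs]
        norm_num
      have hs0 : S k x p y t 0 < 0 := sign_eq_neg_one_iff.1 hs
      rw [hpr, hr0]
      refine mul_nonpos_of_nonneg_of_nonpos ?_ hs0.le
      rcases hy with hy | hy <;> rw [hy] <;> simp
  · have hpr := hdirac r hΔr
    rw [← hpr] at hr
    -- If `x t` lies in no group, `B` may be `0` and the tolerance says nothing, but then `S`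
    -- vanishes identically. Otherwise the diagonal term of round `t` gives `1 ≤ B`, so `|S| ≤ 1/10
    -- ≤ m/10`.
    rcases Nat.eq_zero_or_pos {c ∈ C | x t ∈ c ∧ x t ∈ c}.ncard with hz | hz
    · have hK : intersectionKernel C (x t) (x t) = 0 := by simp only [intersectionKernel, hz]; simp
      have hK' : ∀ x', intersectionKernel C (x t) x' = 0 := fun x' =>
        le_antisymm (hK ▸ intersectionKernel_le_self hm (x t) x') (intersectionKernel_nonneg _ _)
      have hS0 : S k x p y t (p t) = 0 := by simp [S, hk, kMCUnit, kMC, hK']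
      rw [hS0, mul_zero]
      positivity
    · have hK1 : (1 : ℝ) ≤ intersectionKernel C (x t) (x t) := by
        unfold intersectionKernel
        exact_mod_cast hz
      have hB : 1 ≤ B k x p t (p t) := by
        refine le_trans hK1 (le_trans (le_of_eq ?_) (Finset.le_sup' _ (Finset.mem_Iic.2 le_rfl)))
        rw [Function.update_self, hself]
      have hS1 : |S k x p y t (p t)| ≤ 1 / 10 := by
        have h3 : (1 : ℝ) ≤ ((t : ℝ) + 1) ^ 3 := one_le_pow₀ (by simp)
        have h4 : (10 : ℝ) ≤ 10 * ((t : ℝ) + 1) ^ 3 * B k x p t (p t) := by nlinarith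
        have h5 : |S k x p y t (p t)| * 10 ≤ 1 :=
          (mul_le_mul_of_nonneg_left h4 (abs_nonneg _)).trans hr
        linarith
      calc (y t - p t) * S k x p y t (p t) ≤ |(y t - p t) * S k x p y t (p t)| := le_abs_self _
        _ = |y t - p t| * |S k x p y t (p t)| := abs_mul _ _
        _ ≤ 1 * (1 / 10) := mul_le_mul (abs_le.2 ⟨hw1, hw0⟩) hS1 (abs_nonneg _) zero_le_one
        _ ≤ m / 10 := by linarith
  · exact absurd forecastContinuous_kMCUnit hnc

theorem IsTranscript.sum_sum_le (hm : ∀ x : X, {c ∈ C | x ∈ c}.encard ≤ m) {T : ℕ}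
    {x : Fin T → X} {p : Fin T → unitInterval} {y : Fin T → ℝ}
    (h : IsTranscript (kMCUnit C) x p y) :
    ∑ t, ∑ s, kMCUnit C (x t, p t) (x s, p s) * (y t - p t) * (y s - p s) ≤ m * T := by
  rw [sum_sum_mul_mul_eq_sum (fun t s => kMCUnit C (x t, p t) (x s, p s))
    (fun s t => kMCUnit_comm _ _) (fun t => y t - p t)]
  refine (Finset.sum_le_sum fun t _ => h.round_le hm t).trans (le_of_eq ?_)
  simp [mul_comm]

/-- The intersection kernel is the sum of the kernels of the individual groups, so the energy of
the residual on each group is bounded by the total energy. -/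
theorem energy_group_le (hm : ∀ x : X, {c ∈ C | x ∈ c}.encard ≤ m) {T : ℕ}
    (x : Fin T → X) (p w : Fin T → ℝ) (N : ℝ)
    (hpsd : ∀ L : Finset (Fin T), 0 ≤ ∑ t ∈ L, ∑ s ∈ L, Real.exp (-|p t - p s|) * w t * w s)
    (hN : ∑ t, ∑ s, kMC C (p t, x t) (p s, x s) * w t * w s ≤ N)
    (c : Set X) (hc : c ∈ C) (L : Finset (Fin T)) (hL : ∀ t, t ∈ L ↔ x t ∈ c) :
    ∑ t ∈ L, ∑ s ∈ L, Real.exp (-|p t - p s|) * w t * w s ≤ N := by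
  classical
  -- `C` may be infinite; only groups that contain some `x t` contribute to the energy, and `c` is
  -- added to have it in the sum.
  set G : Finset (Set X) :=
    insert c (Finset.univ.biUnion fun t => (finite_groups hm (x t)).toFinset) with hG
  have hGC : ∀ c' ∈ G, c' ∈ C := by
    intro c' h
    simp only [hG, Finset.mem_insert, Finset.mem_biUnion, Set.Finite.mem_toFinset] at h
    rcases h with rfl | ⟨t, -, h⟩
    exacts [hc, h.1]
  have hker : ∀ t s, intersectionKernel C (x t) (x s)
      = ∑ c' ∈ G, if x t ∈ c' ∧ x s ∈ c' then (1 : ℝ) else 0 := by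
    intro t s
    rw [Finset.sum_boole, intersectionKernel, ← Set.ncard_coe_finset]
    congr 2
    ext c'
    simp only [Set.mem_ofPred_eq, Finset.coe_filter]
    refine ⟨fun h => ⟨?_, h.2⟩, fun h => ⟨hGC _ h.1, h.2⟩⟩
    refine Finset.mem_insert_of_mem (Finset.mem_biUnion.2 ⟨t, Finset.mem_univ _, ?_⟩)
    exact (Set.Finite.mem_toFinset _).2 ⟨h.1, h.2.1⟩
  have hQ : ∀ c' : Set X, ∑ t, ∑ s, (if x t ∈ c' ∧ x s ∈ c' then (1 : ℝ) else 0) *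
      (Real.exp (-|p t - p s|) * w t * w s)
      = ∑ t with x t ∈ c', ∑ s with x s ∈ c', Real.exp (-|p t - p s|) * w t * w s := by
    intro c'
    rw [Finset.sum_filter]
    refine Finset.sum_congr rfl fun t _ => ?_
    by_cases h : x t ∈ c'
    · simp [h, Finset.sum_filter]
    · simp [h]
  have hLc : L = Finset.univ.filter fun t => x t ∈ c := by
    ext t
    simp [hL]
  refine le_trans ?_ hN
  have htot : ∑ t, ∑ s, kMC C (p t, x t) (p s, x s) * w t * w s
      = ∑ c' ∈ G, ∑ t with x t ∈ c', ∑ s with x s ∈ c',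
        Real.exp (-|p t - p s|) * w t * w s := by
    simp_rw [← hQ]
    rw [Finset.sum_comm (s := G)]
    refine Finset.sum_congr rfl fun t _ => ?_
    rw [Finset.sum_comm (s := G)]
    refine Finset.sum_congr rfl fun s _ => ?_
    simp only [kMC, kLap]
    rw [hker, Finset.mul_sum, Finset.sum_mul, Finset.sum_mul]
    exact Finset.sum_congr rfl fun c' _ => by ring
  rw [htot, hLc]
  exact Finset.single_le_sum (f := fun c' : Set X => ∑ t with x t ∈ c', ∑ s with x s ∈ c',
        Real.exp (-|p t - p s|) * w t * w s) (fun c' _ => hpsd _) (Finset.mem_insert_self _ _)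

end groups

end AnyKernel

/-! ### Cumulative functions and the Laplace energy -/

open MeasureTheory in
theorem intervalIntegrable_of_bounded {f : ℝ → ℝ} (hf : Measurable f) {M : ℝ}
    (hM : ∀ u, |f u| ≤ M) (a b : ℝ) : IntervalIntegrable f volume a b := by
  rw [intervalIntegrable_iff]
  exact Measure.integrableOn_of_bounded (M := M) (by simp) hf.aestronglyMeasurable
    (Filter.Eventually.of_forall fun u => hM u)

/-- The cumulative sums of weights `c` located at the points `p`. -/
noncomputable def cumulative {ι : Type*} (L : Finset ι) (p c : ι → ℝ) (u : ℝ) : ℝ :=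
  ∑ t ∈ L with p t ≤ u, c t

section cumulative

variable {ι : Type*} (L : Finset ι) (p c : ι → ℝ)

theorem cumulative_eq (u : ℝ) : cumulative L p c u = ∑ t ∈ L, if p t ≤ u then c t else 0 :=
  Finset.sum_filter _ _

theorem measurable_cumulative : Measurable (cumulative L p c) := by
  simp only [funext (cumulative_eq L p c)]
  exact Finset.measurable_sum _ fun t _ =>
    Measurable.ite measurableSet_Ici measurable_const measurable_const

theorem abs_cumulative_le (u : ℝ) : |cumulative L p c u| ≤ ∑ t ∈ L, |c t| :=
  (Finset.abs_sum_le_sum_abs _ _).trans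
    (Finset.sum_le_sum_of_subset_of_nonneg (Finset.filter_subset _ _) fun _ _ _ => abs_nonneg _)

theorem intervalIntegrable_cumulative (a b : ℝ) :
    IntervalIntegrable (cumulative L p c) MeasureTheory.volume a b :=
  intervalIntegrable_of_bounded (measurable_cumulative L p c) (abs_cumulative_le L p c) a b

theorem intervalIntegrable_cumulative_sq (a b : ℝ) :
    IntervalIntegrable (fun u => cumulative L p c u ^ 2) MeasureTheory.volume a b :=
  intervalIntegrable_of_bounded ((measurable_cumulative L p c).pow_const 2)
    (M := (∑ t ∈ L, |c t|) ^ 2)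
    (fun u => by
      rw [abs_pow]
      exact pow_le_pow_left₀ (abs_nonneg _) (abs_cumulative_le L p c u) 2) a b

end cumulative

theorem integral_ite_le {φ : ℝ → ℝ} {a b : ℝ} (ha : 0 ≤ a) (hab : a ≤ b)
    (hφ : IntervalIntegrable φ MeasureTheory.volume 0 b) :
    ∫ u in (0 : ℝ)..b, (if a ≤ u then φ u else 0) = ∫ u in a..b, φ u := by
  have hind : (fun u => if a ≤ u then φ u else 0) = Set.indicator (Set.Ici a) φ := by
    ext u
    simp [Set.indicator_apply]
  have hint : IntervalIntegrable (fun u => if a ≤ u then φ u else 0) MeasureTheory.volume 0 b := by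
    rw [hind]
    rw [intervalIntegrable_iff] at hφ ⊢
    exact hφ.indicator measurableSet_Ici
  have hmem : a ∈ Set.uIcc 0 b := by
    rw [Set.uIcc_of_le (ha.trans hab)]
    exact ⟨ha, hab⟩
  rw [← intervalIntegral.integral_add_adjacent_intervals
    (hint.mono_set (Set.uIcc_subset_uIcc_left hmem))
    (hint.mono_set (Set.uIcc_subset_uIcc_right hmem))]
  -- The integrand is nonzero at most at the endpoint `a`, a null set.
  have h1 : ∫ u in (0 : ℝ)..a, (if a ≤ u then φ u else 0) = 0 := by
    refine intervalIntegral.integral_zero_ae ?_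
    have : ∀ᵐ u : ℝ, u ≠ a := by simp [MeasureTheory.ae_iff]
    filter_upwards [this] with u hu hmem
    rw [Set.uIoc_of_le ha] at hmem
    exact if_neg (not_le.2 (lt_of_le_of_ne hmem.2 hu))
  have h2 : ∫ u in a..b, (if a ≤ u then φ u else 0) = ∫ u in a..b, φ u := by
    refine intervalIntegral.integral_congr fun u hu => ?_
    rw [Set.uIcc_of_le hab] at hu
    exact if_pos hu.1
  rw [h1, h2, zero_add]

/-- Since `|a - b| = 2 max a b - a - b`, it suffices to write `exp (-2 max a b)` as its value at `1`
plus an integral of its derivative. The condition `max a b ≤ u` splits into one on `a` and one on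
`b`, so double sums of the kernel become squares of cumulative functions. -/
theorem exp_neg_abs_sub_eq {a b : ℝ} (ha : 0 ≤ a) (ha1 : a ≤ 1) (hb1 : b ≤ 1) :
    Real.exp (-|a - b|) = Real.exp a * Real.exp b * (Real.exp (-2) +
      ∫ u in (0 : ℝ)..1, if max a b ≤ u then 2 * Real.exp (-2 * u) else 0) := by
  have hcont : Continuous fun u : ℝ => 2 * Real.exp (-2 * u) := by fun_prop
  rw [integral_ite_le (le_max_of_le_left ha) (max_le ha1 hb1) (hcont.intervalIntegrable _ _),
    intervalIntegral.integral_eq_sub_of_hasDerivAt (f := fun u => - Real.exp (-2 * u))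
      (fun u _ => ?_) (hcont.intervalIntegrable _ _), ← Real.exp_add]
  · have : Real.exp (-2) + (-Real.exp (-2 * 1) - -Real.exp (-2 * max a b))
        = Real.exp (-2 * max a b) := by norm_num
    rw [this, ← Real.exp_add]
    congr 1
    rcases le_total a b with h | h
    · rw [max_eq_right h, abs_of_nonpos (by linarith)]; ring
    · rw [max_eq_left h, abs_of_nonneg (by linarith)]; ring
  · have h := (((hasDerivAt_id u).const_mul (-2 : ℝ)).exp).neg
    refine h.congr_deriv ?_
    simp only [id]
    ring

section energy

variable {ι : Type*} {L : Finset ι} {p w : ι → ℝ}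

/-- The energy of a signed measure for the Laplace kernel, as a norm of its cumulative function. -/
theorem energy_eq (hp0 : ∀ t ∈ L, 0 ≤ p t) (hp1 : ∀ t ∈ L, p t ≤ 1) :
    ∑ t ∈ L, ∑ s ∈ L, Real.exp (-|p t - p s|) * w t * w s =
      Real.exp (-2) * (∑ t ∈ L, w t * Real.exp (p t)) ^ 2 + ∫ u in (0 : ℝ)..1,
        2 * Real.exp (-2 * u) * cumulative L p (fun t => w t * Real.exp (p t)) u ^ 2 := by
  have hpt : ∀ u, 2 * Real.exp (-2 * u) * cumulative L p (fun t => w t * Real.exp (p t)) u ^ 2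
      = ∑ t ∈ L, ∑ s ∈ L, (w t * Real.exp (p t)) * (w s * Real.exp (p s)) *
        (if max (p t) (p s) ≤ u then 2 * Real.exp (-2 * u) else 0) := by
    intro u
    rw [cumulative_eq, sq, Finset.sum_mul_sum, Finset.mul_sum]
    refine Finset.sum_congr rfl fun t _ => ?_
    rw [Finset.mul_sum]
    refine Finset.sum_congr rfl fun s _ => ?_
    by_cases h1 : p t ≤ u <;> by_cases h2 : p s ≤ u <;> simp [h1, h2]
    ring
  have hint : ∀ a : ℝ, IntervalIntegrable (fun u => if a ≤ u then 2 * Real.exp (-2 * u) else 0)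
      MeasureTheory.volume 0 1 := by
    intro a
    have hind : (fun u => if a ≤ u then 2 * Real.exp (-2 * u) else 0)
        = Set.indicator (Set.Ici a) (fun u => 2 * Real.exp (-2 * u)) := by
      ext u
      simp [Set.indicator_apply]
    have hcont : Continuous fun u : ℝ => 2 * Real.exp (-2 * u) := by fun_prop
    have h := hcont.intervalIntegrable (μ := MeasureTheory.volume) 0 1
    rw [hind]
    rw [intervalIntegrable_iff] at h ⊢
    exact h.indicator measurableSet_Ici
  simp_rw [hpt]
  rw [intervalIntegral.integral_finsetSum (fun t _ => by
      simpa only [Finset.sum_fn] using IntervalIntegrable.sum (s := L)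
        (f := fun s u => (w t * Real.exp (p t)) * (w s * Real.exp (p s)) *
          (if max (p t) (p s) ≤ u then 2 * Real.exp (-2 * u) else 0))
        fun s _ => (hint _).const_mul _), sq, Finset.sum_mul_sum,
    Finset.mul_sum, ← Finset.sum_add_distrib]
  refine Finset.sum_congr rfl fun t ht => ?_
  rw [intervalIntegral.integral_finsetSum (fun s _ => (hint _).const_mul _), Finset.mul_sum,
    ← Finset.sum_add_distrib]
  refine Finset.sum_congr rfl fun s hs => ?_
  rw [intervalIntegral.integral_const_mul, exp_neg_abs_sub_eq (hp0 t ht) (hp1 t ht) (hp1 s hs)]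
  ring

theorem energy_nonneg (hp0 : ∀ t ∈ L, 0 ≤ p t) (hp1 : ∀ t ∈ L, p t ≤ 1) :
    0 ≤ ∑ t ∈ L, ∑ s ∈ L, Real.exp (-|p t - p s|) * w t * w s := by
  rw [energy_eq hp0 hp1]
  refine add_nonneg (by positivity) (intervalIntegral.integral_nonneg zero_le_one fun u _ => ?_)
  positivity

/-- The weight `2 exp (-2u)` in `energy_eq` is at least `1/4` on `[0,1]` because `exp 2 ≤ 8`, so `∫
Γ² ≤ 4N`; Cauchy–Schwarz gives the rest. -/
theorem integral_abs_cumulative_le (hp0 : ∀ t ∈ L, 0 ≤ p t) (hp1 : ∀ t ∈ L, p t ≤ 1) {N : ℝ}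
    (hN : ∑ t ∈ L, ∑ s ∈ L, Real.exp (-|p t - p s|) * w t * w s ≤ N) :
    ∫ u in (0 : ℝ)..1, |cumulative L p (fun t => w t * Real.exp (p t)) u| ≤ 2 * √N := by
  set Γ := cumulative L p (fun t => w t * Real.exp (p t)) with hΓ
  have hi1 : IntervalIntegrable (fun u => |Γ u|) MeasureTheory.volume 0 1 :=
    (intervalIntegrable_cumulative _ _ _ _ _).abs
  have hi2 : IntervalIntegrable (fun u => Γ u ^ 2) MeasureTheory.volume 0 1 :=
    intervalIntegrable_cumulative_sq _ _ _ _ _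
  have hsq : ∫ u in (0 : ℝ)..1, Γ u ^ 2 ≤ 4 * N := by
    have h1 : ∫ u in (0 : ℝ)..1, 1 / 4 * Γ u ^ 2
        ≤ ∫ u in (0 : ℝ)..1, 2 * Real.exp (-2 * u) * Γ u ^ 2 := by
      refine intervalIntegral.integral_mono_on zero_le_one (hi2.const_mul _)
        (hi2.continuousOn_mul (by fun_prop)) fun u hu => ?_
      refine mul_le_mul_of_nonneg_right ?_ (sq_nonneg _)
      have h2 : Real.exp (-2) ≤ Real.exp (-2 * u) := Real.exp_le_exp.2 (by linarith [hu.2])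
      have h3 : 1 / 8 ≤ Real.exp (-2) := by
        rw [Real.exp_neg, one_div]
        refine inv_anti₀ (Real.exp_pos _) ?_
        have h4 : Real.exp 2 = Real.exp 1 * Real.exp 1 := by rw [← Real.exp_add]; norm_num
        rw [h4]
        nlinarith [Real.exp_one_lt_d9, Real.exp_pos 1]
      linarith
    rw [intervalIntegral.integral_const_mul] at h1
    rw [energy_eq hp0 hp1] at hN
    have h5 : 0 ≤ Real.exp (-2) * (∑ t ∈ L, w t * Real.exp (p t)) ^ 2 := by positivity
    linarith
  have hcs : (∫ u in (0 : ℝ)..1, |Γ u|) ^ 2 ≤ ∫ u in (0 : ℝ)..1, Γ u ^ 2 := by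
    set I := ∫ u in (0 : ℝ)..1, |Γ u|
    -- Cauchy–Schwarz on a unit interval, from `0 ≤ (|Γ u| - I)²`.
    have h1 : ∫ u in (0 : ℝ)..1, (2 * I * |Γ u| - I ^ 2) ≤ ∫ u in (0 : ℝ)..1, Γ u ^ 2 := by
      refine intervalIntegral.integral_mono_on zero_le_one
        ((hi1.const_mul _).sub intervalIntegrable_const) hi2 fun u _ => ?_
      nlinarith [sq_nonneg (|Γ u| - I), sq_abs (Γ u)]
    rw [intervalIntegral.integral_sub (hi1.const_mul _) intervalIntegrable_const,
      intervalIntegral.integral_const_mul, intervalIntegral.integral_const] at h1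
    have h2 : ∫ u in (0 : ℝ)..1, |Γ u| = I := rfl
    rw [h2] at h1
    simp at h1
    nlinarith
  have h0 : 0 ≤ ∫ u in (0 : ℝ)..1, |Γ u| :=
    intervalIntegral.integral_nonneg zero_le_one fun u _ => abs_nonneg _
  have h3 : 2 * √N = √(4 * N) := by
    rw [Real.sqrt_mul (by norm_num), show (4 : ℝ) = 2 ^ 2 by norm_num,
      Real.sqrt_sq (by norm_num)]
  rw [h3]
  exact Real.le_sqrt_of_sq_le (hcs.trans hsq)

/-- Summation by parts: a change of weights in the cumulative function. -/
theorem abs_cumulative_div_le (hp0 : ∀ t ∈ L, 0 ≤ p t) {u : ℝ} (hu0 : 0 ≤ u) (hu : u ≤ 2 / 3) :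
    |cumulative L p (fun t => w t / (1 - p t)) u| ≤
      3 * |cumulative L p (fun t => w t * Real.exp (p t)) u| +
      6 * ∫ s in (0 : ℝ)..1, |cumulative L p (fun t => w t * Real.exp (p t)) s| := by
  set Γ := cumulative L p (fun t => w t * Real.exp (p t)) with hΓ
  -- `φ` is the ratio of the new weight to the old one and `ψ` is its derivative; on `[0, 2/3]` they
  -- are at most `3` and `(2/3) · 9 = 6`.
  set φ : ℝ → ℝ := fun s => Real.exp (-s) / (1 - s) with hφ
  set ψ : ℝ → ℝ := fun s => Real.exp (-s) * s / (1 - s) ^ 2 with hψ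
  have hderiv : ∀ s, s ≤ 2 / 3 → HasDerivAt φ (ψ s) s := by
    intro s hs
    have hne : 1 - s ≠ 0 := by linarith
    have h := (hasDerivAt_neg s).exp.div ((hasDerivAt_id s).const_sub 1) hne
    refine h.congr_deriv ?_
    simp only [hψ, id]
    ring
  have hcont : ContinuousOn ψ (Set.uIcc 0 u) := by
    rw [Set.uIcc_of_le hu0]
    refine ContinuousOn.div (by fun_prop) (by fun_prop) fun s hs => ?_
    have : 0 < 1 - s := by linarith [hs.2]
    positivity
  have hψint : IntervalIntegrable ψ MeasureTheory.volume 0 u := hcont.intervalIntegrable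
  have hexp : ∀ s, 0 ≤ s → Real.exp (-s) ≤ 1 := fun s hs => Real.exp_le_one_iff.2 (by linarith)
  have hφ3 : |φ u| ≤ 3 := by
    have : 0 < 1 - u := by linarith
    rw [abs_of_nonneg (by positivity), div_le_iff₀ this]
    linarith [hexp u hu0]
  have hψ6 : ∀ s ∈ Set.Icc 0 u, |ψ s| ≤ 6 := by
    intro s hs
    have h1 : 0 < 1 - s := by linarith [hs.2]
    have h0 : 0 ≤ s := hs.1
    rw [abs_of_nonneg (by positivity), div_le_iff₀ (by positivity)]
    have h2 : Real.exp (-s) * s ≤ 1 * s := mul_le_mul_of_nonneg_right (hexp s h0) h0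
    have h3 : (1 / 3 : ℝ) ≤ 1 - s := by linarith [hs.2]
    nlinarith [hs.2]
  -- Termwise this is `φ (p t) = φ u - ∫ ψ` over `[p t, u]`.
  have hterm : ∀ t ∈ L, (if p t ≤ u then w t / (1 - p t) else 0) =
      φ u * (if p t ≤ u then w t * Real.exp (p t) else 0) -
        ∫ s in (0 : ℝ)..u, (w t * Real.exp (p t)) * (if p t ≤ s then ψ s else 0) := by
    intro t ht
    rw [intervalIntegral.integral_const_mul]
    by_cases h : p t ≤ u
    · rw [if_pos h, if_pos h, integral_ite_le (hp0 t ht) h hψint,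
        intervalIntegral.integral_eq_sub_of_hasDerivAt (f := φ)]
      · simp only [hφ, Real.exp_neg (p t)]
        have := (Real.exp_pos (p t)).ne'
        have h1 : 1 - p t ≠ 0 := by linarith
        field_simp
        ring
      · intro s hs
        rw [Set.uIcc_of_le h] at hs
        exact hderiv s (by linarith [hs.2])
      · exact hψint.mono_set (Set.uIcc_subset_uIcc_right (by
          rw [Set.uIcc_of_le hu0]; exact ⟨hp0 t ht, h⟩))
    · rw [if_neg h, if_neg h]
      have : ∫ s in (0 : ℝ)..u, (if p t ≤ s then ψ s else 0) = ∫ s in (0 : ℝ)..u, (0 : ℝ) := by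
        refine intervalIntegral.integral_congr fun s hs => ?_
        rw [Set.uIcc_of_le hu0] at hs
        exact if_neg fun h' => h (h'.trans hs.2)
      rw [this]
      simp
  have hite : ∀ a : ℝ, IntervalIntegrable (fun s => if a ≤ s then ψ s else 0)
      MeasureTheory.volume 0 u := by
    intro a
    have hind : (fun s => if a ≤ s then ψ s else 0) = Set.indicator (Set.Ici a) ψ := by
      ext s
      simp [Set.indicator_apply]
    rw [hind]
    have h := hψint
    rw [intervalIntegrable_iff] at h ⊢
    exact h.indicator measurableSet_Ici
  have hmain : cumulative L p (fun t => w t / (1 - p t)) u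
      = φ u * Γ u - ∫ s in (0 : ℝ)..u, ψ s * Γ s := by
    have h1 : ∀ s, ψ s * Γ s
        = ∑ t ∈ L, (w t * Real.exp (p t)) * (if p t ≤ s then ψ s else 0) := by
      intro s
      rw [hΓ, cumulative_eq, Finset.mul_sum]
      refine Finset.sum_congr rfl fun t _ => ?_
      split_ifs <;> ring
    simp_rw [h1]
    rw [intervalIntegral.integral_finsetSum (fun t _ => (hite _).const_mul _), hΓ, cumulative_eq,
      cumulative_eq, Finset.mul_sum, ← Finset.sum_sub_distrib]
    exact Finset.sum_congr rfl hterm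
  have hi1 : ∀ a b, IntervalIntegrable (fun u => |Γ u|) MeasureTheory.volume a b :=
    fun a b => (intervalIntegrable_cumulative _ _ _ _ _).abs
  have hbound : |∫ s in (0 : ℝ)..u, ψ s * Γ s| ≤ 6 * ∫ s in (0 : ℝ)..1, |Γ s| := by
    refine (intervalIntegral.abs_integral_le_integral_abs hu0).trans ?_
    rw [← intervalIntegral.integral_const_mul]
    refine le_trans (intervalIntegral.integral_mono_on hu0 (g := fun s => 6 * |Γ s|)
      ((intervalIntegrable_cumulative _ _ _ _ _).continuousOn_mul hcont).abs
      ((hi1 _ _).const_mul _) fun s hs => ?_) ?_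
    · rw [abs_mul]
      exact mul_le_mul_of_nonneg_right (hψ6 s hs) (abs_nonneg _)
    · exact intervalIntegral.integral_mono_interval le_rfl hu0 (by linarith)
        (Filter.Eventually.of_forall fun s => by positivity) ((hi1 _ _).const_mul _)
  rw [hmain]
  refine (abs_sub _ _).trans (add_le_add ?_ hbound)
  rw [abs_mul]
  exact mul_le_mul_of_nonneg_right hφ3 (abs_nonneg _)

end energy

/-- Comparison of a Riemann sum of a cumulative function with its integral. -/
theorem sum_abs_cumulative_le {ι : Type*} (L : Finset ι) (p c : ι → ℝ) {M : ℝ}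
    (hc : ∀ t ∈ L, |c t| ≤ M) {n : ℕ} (hn : 0 < n) :
    ∑ j ∈ range n, |cumulative L p c ((j : ℝ) / n)| ≤
      n * (∫ u in (0 : ℝ)..1, |cumulative L p c u|) + M * #L := by
  classical
  have hn' : (0 : ℝ) < n := by exact_mod_cast hn
  set Γ := cumulative L p c with hΓ
  have hi : ∀ a b, IntervalIntegrable (fun u => |Γ u|) MeasureTheory.volume a b :=
    fun a b => (intervalIntegrable_cumulative _ _ _ _ _).abs
  -- The total weight inside a cell bounds the change of `Γ` from its left endpoint.
  set g : ℕ → ℝ := fun j => ∑ t ∈ L with (j : ℝ) / n < p t ∧ p t ≤ ((j + 1 : ℕ) : ℝ) / n, |c t|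
    with hg
  have hpt : ∀ j : ℕ, ∀ u ∈ Set.Icc ((j : ℝ) / n) (((j + 1 : ℕ) : ℝ) / n),
      |Γ ((j : ℝ) / n)| - g j ≤ |Γ u| := by
    intro j u hu
    have h1 : Γ u = Γ ((j : ℝ) / n) + ∑ t ∈ L with (j : ℝ) / n < p t ∧ p t ≤ u, c t := by
      rw [hΓ, cumulative_eq, cumulative_eq, Finset.sum_filter, ← Finset.sum_add_distrib]
      refine Finset.sum_congr rfl fun t _ => ?_
      by_cases h2 : p t ≤ (j : ℝ) / n
      · simp [h2, h2.trans hu.1, not_lt.2 h2]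
      · simp [h2, not_le.1 h2]
    have h2 : |∑ t ∈ L with (j : ℝ) / n < p t ∧ p t ≤ u, c t| ≤ g j := by
      refine (Finset.abs_sum_le_sum_abs _ _).trans
        (Finset.sum_le_sum_of_subset_of_nonneg ?_ fun _ _ _ => abs_nonneg _)
      exact Finset.monotone_filter_right _ fun t _ ht => ⟨ht.1, ht.2.trans hu.2⟩
    have h3 : Γ ((j : ℝ) / n) = Γ u - ∑ t ∈ L with (j : ℝ) / n < p t ∧ p t ≤ u, c t := by
      rw [h1]; ring
    have h4 := abs_sub (Γ u) (∑ t ∈ L with (j : ℝ) / n < p t ∧ p t ≤ u, c t)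
    rw [← h3] at h4
    linarith
  have hcell : ∀ j : ℕ, 1 / n * (|Γ ((j : ℝ) / n)| - g j) ≤
      ∫ u in ((j : ℝ) / n)..(((j + 1 : ℕ) : ℝ) / n), |Γ u| := by
    intro j
    have hle : (j : ℝ) / n ≤ ((j + 1 : ℕ) : ℝ) / n := by gcongr; simp
    have h := intervalIntegral.integral_mono_on hle intervalIntegrable_const (hi _ _) (hpt j)
    rw [intervalIntegral.integral_const, smul_eq_mul, ← sub_div] at h
    push_cast at h
    rw [add_sub_cancel_left] at h
    exact_mod_cast h
  have hsum := Finset.sum_le_sum fun j (_ : j ∈ range n) => hcell j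
  rw [intervalIntegral.sum_integral_adjacent_intervals (a := fun j : ℕ => (j : ℝ) / n)
    (fun k _ => hi _ _), ← Finset.mul_sum, Finset.sum_sub_distrib] at hsum
  simp only [Nat.cast_zero, zero_div, div_self hn'.ne'] at hsum
  have hgsum : ∑ j ∈ range n, g j ≤ M * #L := by
    have h1 : ∑ j ∈ range n, g j ≤ ∑ t ∈ L, |c t| := by
      simp only [hg]
      rw [← Finset.sum_biUnion]
      · exact Finset.sum_le_sum_of_subset_of_nonneg
          (Finset.biUnion_subset.2 fun j _ => Finset.filter_subset _ _) fun _ _ _ => abs_nonneg _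
      · have hlt : ∀ i j : ℕ, i < j → Disjoint
            (L.filter fun t => (i : ℝ) / n < p t ∧ p t ≤ ((i + 1 : ℕ) : ℝ) / n)
            (L.filter fun t => (j : ℝ) / n < p t ∧ p t ≤ ((j + 1 : ℕ) : ℝ) / n) := by
          intro i j hij
          refine Finset.disjoint_left.2 fun t h1 h2 => ?_
          have h3 := (Finset.mem_filter.1 h1).2.2
          have h4 := (Finset.mem_filter.1 h2).2.1
          have h5 : ((i + 1 : ℕ) : ℝ) / n ≤ (j : ℝ) / n := by
            gcongr
            exact hij
          linarith
        intro i _ j _ hij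
        rcases lt_or_gt_of_ne hij with h | h
        exacts [hlt i j h, (hlt j i h).symm]
    refine h1.trans ((Finset.sum_le_card_nsmul _ _ _ hc).trans (le_of_eq ?_))
    rw [nsmul_eq_mul, mul_comm]
  rw [one_div, inv_mul_le_iff₀ hn'] at hsum
  linarith

/-! ### Transport of the ones to a grid, and calibration by averaging -/

/-- A ranking of a finite set that is compatible with a real-valued function on it. -/
theorem exists_rank {ι : Type*} (f : ι → ℝ) (s : Finset ι) :
    ∃ r : ι → ℕ, (∀ k, #{t ∈ s | r t < k} = min k #s) ∧
      ∀ t ∈ s, ∀ u, f t ≤ u ↔ r t < #{a ∈ s | f a ≤ u} := by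
  classical
  -- Elements are added in increasing order of `f`; the new maximum receives the next free rank
  -- `#s`, so sublevel sets are initial segments.
  induction s using Finset.induction_on_max_value f with
  | empty => exact ⟨fun _ => 0, by simp, by simp⟩
  | insert a s ha hmax ih =>
    obtain ⟨r, hr, hu⟩ := ih
    have hne : ∀ t ∈ s, t ≠ a := fun t ht h => ha (h ▸ ht)
    have hlt : ∀ t ∈ s, r t < #s := by
      have h := hr #s
      rw [min_self] at h
      exact Finset.filter_eq_self.1
        (Finset.eq_of_subset_of_card_le (Finset.filter_subset _ s) h.ge)
    refine ⟨Function.update r a #s, fun k => ?_, fun t ht u => ?_⟩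
    · have h1 : #{t ∈ s | Function.update r a #s t < k} = min k #s := by
        rw [← hr k]
        congr 1
        refine Finset.filter_congr fun t ht => ?_
        rw [Function.update_of_ne (hne t ht)]
      rw [Finset.filter_insert, Function.update_self, Finset.card_insert_of_notMem ha]
      split_ifs with h
      · rw [Finset.card_insert_of_notMem (by simp [ha]), h1]
        omega
      · rw [h1]
        omega
    · rw [Finset.filter_insert]
      have hle : #{a ∈ s | f a ≤ u} ≤ #s := Finset.card_filter_le _ _
      rcases Finset.mem_insert.1 ht with rfl | ht
      · rw [Function.update_self]
        split_ifs with h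
        · have hall : {x ∈ s | f x ≤ u} = s :=
            Finset.filter_eq_self.2 fun x hx => (hmax x hx).trans h
          simp [hall, ha, h]
        · simp [h, hle]
      · rw [Function.update_of_ne (hne t ht)]
        split_ifs with h
        · have hall : {x ∈ s | f x ≤ u} = s :=
            Finset.filter_eq_self.2 fun x hx => (hmax x hx).trans h
          rw [Finset.card_insert_of_notMem (by simp [ha]), hall]
          have := hlt t ht
          have := (hmax t ht).trans h
          simp only [this, true_iff]
          omega
        · exact hu t ht u

/-- Replacing the labels of a partition by the averages of the outcomes on its parts gives a
perfectly calibrated sequence. -/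
theorem exists_calibrated_of_partition {ι : Type*} (L : Finset ι) (p y : ι → ℝ)
    (hy : ∀ t ∈ L, y t = 0 ∨ y t = 1) (n : ℕ) (b : ι → ℕ) (hb : ∀ t ∈ L, b t ≤ n) (v : ℕ → ℝ) :
    ∃ q : ι → ℝ, (∀ t ∈ L, 0 ≤ q t ∧ q t ≤ 1) ∧
      (∀ z, ∑ t ∈ L, (if q t = z then y t - z else 0) = 0) ∧
      ∑ t ∈ L, |p t - q t| ≤ ∑ t ∈ L, |p t - v (b t)| +
        ∑ j ∈ range (n + 1), |∑ t ∈ L with b t = j, (y t - v j)| := by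
  classical
  set g : ℕ → ℝ := fun j => (∑ t ∈ L with b t = j, y t) / #{t ∈ L | b t = j} with hg
  have hsum : ∀ j, ∑ t ∈ L with b t = j, y t = #{t ∈ L | b t = j} * g j := by
    intro j
    by_cases h : #{t ∈ L | b t = j} = 0
    · rw [h, Finset.card_eq_zero.1 h]
      simp
    · have : (#{t ∈ L | b t = j} : ℝ) ≠ 0 := by exact_mod_cast h
      simp only [hg]
      field_simp
  have hmaps : ∀ t ∈ L, b t ∈ range (n + 1) := fun t ht =>
    Finset.mem_range.2 (Nat.lt_succ_of_le (hb t ht))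
  refine ⟨fun t => g (b t), fun t ht => ⟨?_, ?_⟩, fun z => ?_, ?_⟩
  · refine div_nonneg (Finset.sum_nonneg fun s hs => ?_) (Nat.cast_nonneg _)
    rcases hy s (Finset.mem_filter.1 hs).1 with h | h <;> simp [h]
  · refine div_le_one_of_le₀ ?_ (Nat.cast_nonneg _)
    rw [Finset.card_eq_sum_ones]
    push_cast
    refine Finset.sum_le_sum fun s hs => ?_
    rcases hy s (Finset.mem_filter.1 hs).1 with h | h <;> simp [h]
  -- Each part sums to zero separately, so parts with equal averages may merge.
  · rw [← Finset.sum_fiberwise_of_maps_to hmaps]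
    refine Finset.sum_eq_zero fun j _ => ?_
    have : ∀ t ∈ L.filter (fun t => b t = j), (if g (b t) = z then y t - z else 0)
        = if g j = z then y t - z else 0 := by
      intro t ht
      rw [(Finset.mem_filter.1 ht).2]
    rw [Finset.sum_congr rfl this]
    split_ifs with h
    · rw [Finset.sum_sub_distrib, hsum, Finset.sum_const, nsmul_eq_mul, h, sub_self]
    · simp
  · have h1 : ∑ t ∈ L, |v (b t) - g (b t)|
        = ∑ j ∈ range (n + 1), |∑ t ∈ L with b t = j, (y t - v j)| := by
      rw [← Finset.sum_fiberwise_of_maps_to hmaps]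
      refine Finset.sum_congr rfl fun j _ => ?_
      have : ∀ t ∈ L.filter (fun t => b t = j), |v (b t) - g (b t)| = |v j - g j| := by
        intro t ht
        rw [(Finset.mem_filter.1 ht).2]
      rw [Finset.sum_congr rfl this, Finset.sum_sub_distrib, hsum, Finset.sum_const,
        Finset.sum_const, nsmul_eq_mul, nsmul_eq_mul, ← mul_sub, abs_mul, Nat.abs_cast,
        abs_sub_comm]
    rw [← h1, ← Finset.sum_add_distrib]
    exact Finset.sum_le_sum fun t _ => abs_sub_le _ _ _

set_option maxHeartbeats 1000000 in
/-- Assignment of forecasts in `[0, 2/3]` to the points of a grid with small total displacement and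
small total imbalance: the zeros move to a neighbouring grid point and the ones are transported
monotonically. -/
theorem exists_grid_assignment {ι : Type*} (L : Finset ι) (p y : ι → ℝ)
    (hp0 : ∀ t ∈ L, 0 ≤ p t) (hp1 : ∀ t ∈ L, p t ≤ 2 / 3) (hy : ∀ t ∈ L, y t = 0 ∨ y t = 1)
    (n : ℕ) (hn : 0 < n) (D : ℝ)
    (hD : ∑ j ∈ range n, |∑ t ∈ L with p t ≤ (j : ℝ) / n, (y t - p t) / (1 - p t)| ≤ n * D)
    (hD' : |∑ t ∈ L, (y t - p t) / (1 - p t)| ≤ D) :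
    ∃ b : ι → ℕ, (∀ t ∈ L, b t ≤ n) ∧
      ∑ t ∈ L, |p t - (b t : ℝ) / n| ≤ #L / n + D + 1 ∧
      ∑ j ∈ range (n + 1), |∑ t ∈ L with b t = j, (y t - (j : ℝ) / n)| ≤ n + D + 3 * #L / n := by
  classical
  have hn' : (0 : ℝ) < n := by exact_mod_cast hn
  set O := L.filter (fun t => y t = 1) with hO
  set Z := L.filter (fun t => y t = 0) with hZ
  have hOL : ∀ t ∈ O, t ∈ L := fun t ht => (Finset.mem_filter.1 ht).1
  have hZL : ∀ t ∈ Z, t ∈ L := fun t ht => (Finset.mem_filter.1 ht).1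
  have hOy : ∀ t ∈ O, y t = 1 := fun t ht => (Finset.mem_filter.1 ht).2
  have hZy : ∀ t ∈ Z, y t = 0 := fun t ht => (Finset.mem_filter.1 ht).2
  have hnot : L.filter (fun t => ¬ y t = 1) = Z := by
    refine Finset.filter_congr fun t ht => ?_
    rcases hy t ht with h | h <;> simp [h]
  have hsplit : ∀ f : ι → ℝ, ∑ t ∈ L, f t = ∑ t ∈ O, f t + ∑ t ∈ Z, f t := by
    intro f
    rw [← hnot, hO, Finset.sum_filter_add_sum_filter_not]
  have hsplit' : ∀ (P : ι → Prop) [DecidablePred P] (f : ι → ℝ), ∑ t ∈ L with P t, f t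
      = ∑ t ∈ O with P t, f t + ∑ t ∈ Z with P t, f t := by
    intro P _ f
    simp only [Finset.sum_filter P]
    exact hsplit _
  obtain ⟨r, hr, hru⟩ := exists_rank p O
  -- Cumulative demand for ones; `A` below is its integer part.
  set α : ℕ → ℝ := fun j => ∑ t ∈ Z with p t ≤ (j : ℝ) / n, p t / (1 - p t) with hα
  have hpos : ∀ t ∈ L, 0 < 1 - p t := fun t ht => by linarith [hp1 t ht]
  have hterm : ∀ t ∈ L, 0 ≤ p t / (1 - p t) := fun t ht =>
    div_nonneg (hp0 t ht) (hpos t ht).le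
  have hαmono : Monotone α := by
    intro i j hij
    refine Finset.sum_le_sum_of_subset_of_nonneg ?_ fun t ht _ =>
      hterm t (hZL t (Finset.mem_filter.1 ht).1)
    refine Finset.monotone_filter_right _ fun t _ ht => ?_
    exact le_trans ht (by gcongr)
  have hα0 : ∀ j, 0 ≤ α j := fun j => Finset.sum_nonneg fun t ht =>
    hterm t (hZL t (Finset.mem_filter.1 ht).1)
  have hαtot : ∀ j, α j ≤ ∑ t ∈ Z, p t / (1 - p t) := fun j =>
    Finset.sum_le_sum_of_subset_of_nonneg (Finset.filter_subset _ _)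
      fun t ht _ => hterm t (hZL t ht)
  have hαzero : α 0 = 0 := by
    refine Finset.sum_eq_zero fun t ht => ?_
    have h := (Finset.mem_filter.1 ht)
    have : p t = 0 := le_antisymm (by simpa using h.2) (hp0 t (hZL t h.1))
    simp [this]
  set A : ℕ → ℕ := fun j => ⌊α j⌋₊ with hA
  have hAmono : Monotone A := fun i j hij => Nat.floor_mono (hαmono hij)
  have hex : ∀ t, ∃ j, n ≤ j ∨ r t < A j := fun t => ⟨n, Or.inl le_rfl⟩
  -- The one of rank `r t` goes to the first grid point by which more than `r t` ones are demanded.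
  -- Leftover ones go to `n`, whose label is `1`, where ones create no imbalance.
  set J : ι → ℕ := fun t => Nat.find (hex t) with hJ
  have hJn : ∀ t, J t ≤ n := fun t => Nat.find_min' _ (Or.inl le_rfl)
  have hJlt : ∀ t, ∀ j < n, j < J t ↔ A j ≤ r t := by
    intro t j hj
    rw [hJ, Nat.lt_find_iff]
    constructor
    · intro h
      have := h j le_rfl
      push Not at this
      exact this.2
    · intro h i hi
      push Not
      exact ⟨hi.trans_lt hj, (hAmono hi).trans h⟩
  -- Rounding up preserves the cumulative counts at grid points exactly (`hIle`).
  set I : ι → ℕ := fun t => ⌈n * p t⌉₊ with hI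
  have hIle : ∀ t (j : ℕ), I t ≤ j ↔ p t ≤ (j : ℝ) / n := by
    intro t j
    rw [hI, Nat.ceil_le, le_div_iff₀ hn', mul_comm]
  have hIn : ∀ t ∈ L, I t ≤ n := by
    intro t ht
    rw [hIle, div_self hn'.ne']
    linarith [hp1 t ht]
  have hIclose : ∀ t ∈ L, p t ≤ (I t : ℝ) / n ∧ (I t : ℝ) / n - p t ≤ 1 / n := by
    intro t ht
    refine ⟨(hIle t _).1 le_rfl, ?_⟩
    have := Nat.ceil_lt_add_one (mul_nonneg hn'.le (hp0 t ht))
    rw [sub_le_iff_le_add, div_le_iff₀ hn', add_mul, one_div, inv_mul_cancel₀ hn'.ne']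
    simp only [hI]
    linarith
  set cnt : ℕ → ℕ := fun j => #{t ∈ O | J t ≤ j} with hcnt
  have hcntA : ∀ j < n, cnt j = min (A j) #O := by
    intro j hj
    rw [← hr, hcnt]
    refine congrArg _ (Finset.filter_congr fun t _ => ?_)
    rw [← not_lt, hJlt t j hj, not_le]
  set o : ℕ → ℕ := fun j => #{t ∈ O | p t ≤ (j : ℝ) / n} with ho
  have hoM : ∀ j, o j ≤ #O := fun j => Finset.card_filter_le _ _
  have hF : ∀ j : ℕ, ∑ t ∈ L with p t ≤ (j : ℝ) / n, (y t - p t) / (1 - p t) = o j - α j := by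
    intro j
    rw [hsplit']
    simp only [ho, hα]
    rw [Finset.card_eq_sum_ones, sub_eq_add_neg, ← Finset.sum_neg_distrib]
    push_cast
    congr 1
    · refine Finset.sum_congr rfl fun t ht => ?_
      have h := (Finset.mem_filter.1 ht).1
      rw [hOy t h, div_self (hpos t (hOL t h)).ne']
    · refine Finset.sum_congr rfl fun t ht => ?_
      rw [hZy t (Finset.mem_filter.1 ht).1]
      ring
  have hFtot : ∑ t ∈ L, (y t - p t) / (1 - p t) = #O - ∑ t ∈ Z, p t / (1 - p t) := by
    rw [hsplit, Finset.card_eq_sum_ones, sub_eq_add_neg, ← Finset.sum_neg_distrib]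
    push_cast
    congr 1
    · refine Finset.sum_congr rfl fun t ht => ?_
      rw [hOy t ht, div_self (hpos t (hOL t ht)).ne']
    · refine Finset.sum_congr rfl fun t ht => ?_
      rw [hZy t ht]
      ring
  have hfl : ∀ j, (A j : ℝ) ≤ α j ∧ α j < A j + 1 := fun j =>
    ⟨Nat.floor_le (hα0 j), Nat.lt_floor_add_one _⟩
  have hcount : ∀ i ≤ n, (i : ℝ) = ∑ j ∈ range n, if j < i then (1 : ℝ) else 0 := by
    intro i hi
    rw [← Finset.sum_filter, Finset.sum_const, nsmul_eq_mul, mul_one]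
    have : (range n).filter (fun j => j < i) = range i := by
      ext j
      simp only [Finset.mem_filter, Finset.mem_range]
      omega
    rw [this, Finset.card_range]
  -- displacement of the ones
  have hmove : ∑ t ∈ O, |(I t : ℝ) - J t| ≤ n * D + n := by
    calc ∑ t ∈ O, |(I t : ℝ) - J t|
        ≤ ∑ t ∈ O, ∑ j ∈ range n,
          |(if j < I t then (1 : ℝ) else 0) - if j < J t then (1 : ℝ) else 0| := by
          refine Finset.sum_le_sum fun t ht => ?_
          rw [hcount (I t) (hIn t (hOL t ht)), hcount (J t) (hJn t), ← Finset.sum_sub_distrib]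
          exact Finset.abs_sum_le_sum_abs _ _
      _ = ∑ j ∈ range n, ∑ t ∈ O,
          |(if j < I t then (1 : ℝ) else 0) - if j < J t then (1 : ℝ) else 0| :=
          Finset.sum_comm
      _ = ∑ j ∈ range n, |(cnt j : ℝ) - o j| := by
          refine Finset.sum_congr rfl fun j hj => ?_
          have hjn := Finset.mem_range.1 hj
          have h1 : ∀ t ∈ O, (j < I t ↔ o j ≤ r t) := by
            intro t ht
            rw [← not_le, hIle, hru t ht, not_lt]
          have h2 : ∀ t ∈ O, ((if j < I t then (1 : ℝ) else 0) - if j < J t then (1 : ℝ) else 0)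
              = (if J t ≤ j then 1 else 0) - if p t ≤ (j : ℝ) / n then 1 else 0 := by
            intro t ht
            simp only [← hIle, ← not_lt]
            by_cases h3 : j < I t <;> by_cases h4 : j < J t <;> simp [h3, h4]
          have h3 : ∑ t ∈ O, ((if j < I t then (1 : ℝ) else 0) - if j < J t then (1 : ℝ) else 0)
              = cnt j - o j := by
            rw [Finset.sum_congr rfl h2, Finset.sum_sub_distrib, Finset.sum_boole,
              Finset.sum_boole]
          rw [← h3]
          -- Before and after the move, the ones at or left of grid point `j` form initial segments
          -- of the ranking. These are nested, so all terms have one sign and no cancellation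
          -- occurs.
          rcases le_total (o j) (A j) with h | h
          · have : ∀ t ∈ O, 0 ≤ (if j < I t then (1 : ℝ) else 0)
                - if j < J t then (1 : ℝ) else 0 := by
              intro t ht
              by_cases h4 : j < J t
              · have h5 : j < I t := (h1 t ht).2 (h.trans ((hJlt t j hjn).1 h4))
                simp [h4, h5]
              · simp only [h4, if_false]
                split_ifs <;> simp
            rw [abs_of_nonneg (Finset.sum_nonneg this)]
            exact Finset.sum_congr rfl fun t ht => abs_of_nonneg (this t ht)
          · have : ∀ t ∈ O, (if j < I t then (1 : ℝ) else 0)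
                - (if j < J t then (1 : ℝ) else 0) ≤ 0 := by
              intro t ht
              by_cases h4 : j < I t
              · have h5 : j < J t := (hJlt t j hjn).2 (h.trans ((h1 t ht).1 h4))
                simp [h4, h5]
              · simp only [h4, if_false]
                split_ifs <;> simp
            rw [abs_of_nonpos (Finset.sum_nonpos this), ← Finset.sum_neg_distrib]
            exact Finset.sum_congr rfl fun t ht => abs_of_nonpos (this t ht)
      _ ≤ ∑ j ∈ range n,
          (|∑ t ∈ L with p t ≤ (j : ℝ) / n, (y t - p t) / (1 - p t)| + 1) := by
          refine Finset.sum_le_sum fun j hj => ?_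
          -- Taking the integer part costs at most `1`, and capping at `#O` costs nothing more since
          -- `o j ≤ #O`.
          rw [hF, hcntA j (Finset.mem_range.1 hj)]
          have h1 : (o j : ℝ) ≤ #O := by exact_mod_cast hoM j
          obtain ⟨h2, h3⟩ := hfl j
          push_cast
          rw [abs_le]
          have h4 := neg_abs_le ((o j : ℝ) - α j)
          have h5 := le_abs_self ((o j : ℝ) - α j)
          constructor
          · rcases le_total (A j : ℝ) #O with h | h
            · rw [min_eq_left h]; linarith
            · rw [min_eq_right h]; linarith [abs_nonneg ((o j : ℝ) - α j)]
          · linarith [min_le_left (A j : ℝ) #O]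
      _ ≤ n * D + n := by
          rw [Finset.sum_add_distrib, Finset.sum_const, Finset.card_range, nsmul_eq_mul, mul_one]
          linarith
  set b : ι → ℕ := fun t => if y t = 1 then J t else I t with hb
  have hbO : ∀ t ∈ O, b t = J t := fun t ht => by simp [hb, hOy t ht]
  have hbZ : ∀ t ∈ Z, b t = I t := fun t ht => by simp [hb, hZy t ht]
  refine ⟨b, fun t ht => ?_, ?_, ?_⟩
  · simp only [hb]
    split_ifs
    exacts [hJn t, hIn t ht]
  · have hbd : ∀ t ∈ L, |p t - (b t : ℝ) / n|
        ≤ 1 / n + (if y t = 1 then |(I t : ℝ) - J t| / n else 0) := by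
      intro t ht
      obtain ⟨h1, h2⟩ := hIclose t ht
      have h3 : |p t - (I t : ℝ) / n| ≤ 1 / n := by
        rw [abs_sub_comm, abs_of_nonneg (by linarith)]
        exact h2
      simp only [hb]
      split_ifs
      · refine (abs_sub_le _ ((I t : ℝ) / n) _).trans (add_le_add h3 ?_)
        rw [← sub_div, abs_div, abs_of_pos hn']
      · simpa using h3
    refine (Finset.sum_le_sum hbd).trans ?_
    rw [Finset.sum_add_distrib, ← Finset.sum_filter, Finset.sum_const,
      nsmul_eq_mul, mul_one_div, add_assoc, ← Finset.sum_div]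
    refine add_le_add le_rfl ?_
    rw [div_le_iff₀ hn']
    linarith
  -- `e` is supply minus demand after the transport; `g` is minus the demand in excess of the total
  -- supply. They differ only by integer rounding, and `g` is antitone with total drop at most `D`.
  · set e : ℕ → ℝ := fun j => cnt j - α j with he
    set g : ℕ → ℝ := fun j => min (α j) #O - α j with hgdef
    have hW : ∀ j : ℕ, |∑ t ∈ L with b t = j + 1, (y t - ((j + 1 : ℕ) : ℝ) / n)|
        ≤ |1 - ((j + 1 : ℕ) : ℝ) / n| * |e (j + 1) - e j| + 3 / n * #{t ∈ Z | I t = j + 1} := by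
      intro j
      set v : ℝ := ((j + 1 : ℕ) : ℝ) / n with hv
      have hOj : ∑ t ∈ O with b t = j + 1, (y t - v) = (1 - v) * (cnt (j + 1) - cnt j) := by
        have h1 : cnt (j + 1) = cnt j + #{t ∈ O | b t = j + 1} := by
          rw [hcnt, ← Finset.card_union_of_disjoint]
          · refine congrArg _ ?_
            ext t
            simp only [Finset.mem_filter, Finset.mem_union]
            constructor
            · rintro ⟨h, h'⟩
              rw [hbO t h]
              exact (Nat.le_succ_iff.1 h').imp (fun h'' => ⟨h, h''⟩) fun h'' => ⟨h, h''⟩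
            · rintro (⟨h, h'⟩ | ⟨h, h'⟩)
              · exact ⟨h, h'.trans (Nat.le_succ _)⟩
              · rw [hbO t h] at h'
                exact ⟨h, h'.le⟩
          · refine Finset.disjoint_left.2 fun t h1 h2 => ?_
            have h3 := Finset.mem_filter.1 h1
            have h4 := Finset.mem_filter.1 h2
            rw [hbO t h3.1] at h4
            omega
        rw [h1]
        push_cast
        rw [add_sub_cancel_left, Finset.sum_congr rfl (g := fun _ => 1 - v), Finset.sum_const,
          nsmul_eq_mul, mul_comm]
        intro t ht
        rw [hOy t (Finset.mem_filter.1 ht).1]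
      have hZj : ∑ t ∈ Z with b t = j + 1, (y t - v) = - ((1 - v) * (α (j + 1) - α j)) +
          ∑ t ∈ Z with I t = j + 1, (p t - v) / (1 - p t) := by
        have h0 : Z.filter (fun t => b t = j + 1) = Z.filter (fun t => I t = j + 1) :=
          Finset.filter_congr fun t ht => by rw [hbZ t ht]
        have h1 : α (j + 1) = α j + ∑ t ∈ Z with I t = j + 1, p t / (1 - p t) := by
          simp only [hα, ← hIle, Finset.sum_filter]
          rw [← Finset.sum_add_distrib]
          refine Finset.sum_congr rfl fun t _ => ?_
          rcases lt_trichotomy (I t) (j + 1) with h | h | h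
          · rw [if_pos h.le, if_pos (Nat.lt_succ_iff.1 h), if_neg h.ne, add_zero]
          · rw [if_pos h.le, if_neg (by omega), if_pos h, zero_add]
          · rw [if_neg (by omega), if_neg (by omega), if_neg (by omega), zero_add]
        rw [h0, h1, add_sub_cancel_left, Finset.mul_sum, ← Finset.sum_neg_distrib,
          ← Finset.sum_add_distrib]
        refine Finset.sum_congr rfl fun t ht => ?_
        have h2 := (Finset.mem_filter.1 ht).1
        have h3 := (hpos t (hZL t h2)).ne'
        rw [hZy t h2]
        field_simp
        ring
      have hbound : |∑ t ∈ Z with I t = j + 1, (p t - v) / (1 - p t)|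
          ≤ 3 / n * #{t ∈ Z | I t = j + 1} := by
        refine (Finset.abs_sum_le_sum_abs _ _).trans ?_
        rw [mul_comm, ← nsmul_eq_mul]
        refine Finset.sum_le_card_nsmul _ _ _ fun t ht => ?_
        obtain ⟨h2, h3⟩ := Finset.mem_filter.1 ht
        obtain ⟨h4, h5⟩ := hIclose t (hZL t h2)
        rw [h3, ← hv] at h4 h5
        rw [abs_div, abs_of_pos (hpos t (hZL t h2)), abs_sub_comm, abs_of_nonneg (by linarith),
          div_le_iff₀ (hpos t (hZL t h2))]
        have h6 := hp1 t (hZL t h2)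
        have h7 : 0 < 1 / (n : ℝ) := by positivity
        have h8 : (3 : ℝ) / n = 3 * (1 / n) := by ring
        rw [h8]
        nlinarith
      have : ∑ t ∈ L with b t = j + 1, (y t - v) = (1 - v) * (e (j + 1) - e j) +
          ∑ t ∈ Z with I t = j + 1, (p t - v) / (1 - p t) := by
        rw [hsplit', hOj, hZj]
        simp only [he]
        ring
      rw [this]
      refine (abs_add_le _ _).trans (add_le_add ?_ hbound)
      rw [abs_mul]
    -- There is no demand at `0`, so no one is sent there, and zeros are exact at label `0`.
    have hW0 : ∑ t ∈ L with b t = 0, (y t - ((0 : ℕ) : ℝ) / n) = 0 := by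
      rw [hsplit']
      have h1 : ∑ t ∈ O with b t = 0, (y t - ((0 : ℕ) : ℝ) / n) = 0 := by
        have h2 : O.filter (fun t => b t = 0) = ∅ := by
          refine Finset.filter_eq_empty_iff.2 fun t ht h => ?_
          rw [hbO t ht] at h
          have h3 : 0 < J t := (hJlt t 0 hn).2 (by simp [hA, hαzero])
          omega
        rw [h2, Finset.sum_empty]
      rw [h1, zero_add]
      refine Finset.sum_eq_zero fun t ht => ?_
      rw [hZy t (Finset.mem_filter.1 ht).1]
      simp
    have hediff : ∀ j, j + 1 < n → |e (j + 1) - e j| ≤ 1 + (g j - g (j + 1)) := by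
      intro j hj
      have hx : ∀ i < n, -1 ≤ e i - g i ∧ e i - g i ≤ 0 := by
        intro i hi
        simp only [he, hgdef]
        rw [hcntA i hi]
        obtain ⟨h2, h3⟩ := hfl i
        push_cast
        constructor
        · rcases le_total (A i : ℝ) #O with h | h
          · rw [min_eq_left h]; linarith [min_le_left (α i) (#O : ℝ)]
          · rw [min_eq_right h]; linarith [min_le_right (α i) (#O : ℝ)]
        · linarith [min_le_min_right (#O : ℝ) h2]
      have hgm : g (j + 1) ≤ g j := by
        simp only [hgdef]
        have := hαmono (Nat.le_succ j)
        rcases le_total (α j) (#O : ℝ) with h | h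
        · rw [min_eq_left h]; linarith [min_le_left (α (j + 1)) (#O : ℝ)]
        · rw [min_eq_right h]; linarith [min_le_right (α (j + 1)) (#O : ℝ)]
      have h1 := hx j (by omega)
      have h2 := hx (j + 1) hj
      rw [abs_le]
      constructor <;> linarith
    have hsumE : ∑ j ∈ range n, |1 - ((j + 1 : ℕ) : ℝ) / n| * |e (j + 1) - e j| ≤ n + D := by
      obtain ⟨k, rfl⟩ : ∃ k, n = k + 1 := ⟨n - 1, by omega⟩
      -- At the last grid point the factor `1 - v` vanishes, which hides the uncontrolled pile of
      -- leftover ones.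
      rw [Finset.sum_range_succ, div_self hn'.ne', sub_self, abs_zero, zero_mul, add_zero]
      have h1 : ∀ j ∈ range k, |1 - ((j + 1 : ℕ) : ℝ) / (k + 1 : ℕ)| * |e (j + 1) - e j|
          ≤ 1 + (g j - g (j + 1)) := by
        intro j hj
        have hj := Finset.mem_range.1 hj
        refine le_trans ?_ (hediff j (by omega))
        refine mul_le_of_le_one_left (abs_nonneg _) ?_
        have h2 : ((j + 1 : ℕ) : ℝ) / (k + 1 : ℕ) ≤ 1 := by
          rw [div_le_one hn']
          exact_mod_cast (by omega : j + 1 ≤ k + 1)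
        rw [abs_of_nonneg (by linarith)]
        have : 0 ≤ ((j + 1 : ℕ) : ℝ) / (k + 1 : ℕ) := by positivity
        linarith
      refine (Finset.sum_le_sum h1).trans ?_
      rw [Finset.sum_add_distrib, Finset.sum_range_sub', Finset.sum_const, Finset.card_range,
        nsmul_eq_mul, mul_one]
      have hg0 : g 0 ≤ 0 := by simp only [hgdef]; linarith [min_le_left (α 0) (#O : ℝ)]
      have hgk : - g k ≤ D := by
        simp only [hgdef]
        rw [hFtot] at hD'
        have h3 := neg_abs_le ((#O : ℝ) - ∑ t ∈ Z, p t / (1 - p t))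
        rcases le_total (α k) (#O : ℝ) with h | h
        · rw [min_eq_left h]; linarith [abs_nonneg ((#O : ℝ) - ∑ t ∈ Z, p t / (1 - p t))]
        · rw [min_eq_right h]; linarith [hαtot k]
      push_cast
      linarith
    have hsumZ : ∑ j ∈ range n, (3 / n * #{t ∈ Z | I t = j + 1} : ℝ) ≤ 3 * #L / n := by
      rw [← Finset.mul_sum, mul_comm (3 : ℝ), mul_div_assoc, mul_comm]
      refine mul_le_mul_of_nonneg_right ?_ (by positivity)
      have h1 : ∑ j ∈ range n, #{t ∈ Z | I t = j + 1} ≤ #Z := by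
        rw [← Finset.card_biUnion]
        · exact Finset.card_le_card
            (Finset.biUnion_subset.2 fun j _ => Finset.filter_subset _ _)
        · intro i _ j _ hij
          refine Finset.disjoint_left.2 fun t h1 h2 => hij ?_
          have h3 := (Finset.mem_filter.1 h1).2
          have h4 := (Finset.mem_filter.1 h2).2
          omega
      exact_mod_cast h1.trans (Finset.card_filter_le _ _)
    rw [Finset.sum_range_succ', hW0, abs_zero, add_zero]
    refine (Finset.sum_le_sum fun j _ => hW j).trans ?_
    rw [Finset.sum_add_distrib]
    linarith

/-! ### Assembly: choice of the grid, the cut and the reflection -/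

/-- If a bounded energy is combined with a small cumulative sum at `θ ≤ 2 / 3`, then the forecasts
in `[0, θ]` are close to perfectly calibrated ones. -/
theorem exists_calibrated_below {ι : Type*} (L : Finset ι) (p y : ι → ℝ)
    (hp0 : ∀ t ∈ L, 0 ≤ p t) (hp1 : ∀ t ∈ L, p t ≤ 1) (hy : ∀ t ∈ L, y t = 0 ∨ y t = 1)
    {N : ℝ} (hN1 : 1 ≤ N) (hLN : #L ≤ N)
    (hN : ∑ t ∈ L, ∑ s ∈ L, Real.exp (-|p t - p s|) * (y t - p t) * (y s - p s) ≤ N)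
    {θ : ℝ} (hθ0 : 0 ≤ θ) (hθ1 : θ ≤ 2 / 3)
    (hθ : |cumulative L p (fun t => (y t - p t) * Real.exp (p t)) θ| ≤ 13 * √N) :
    ∃ q : ι → ℝ, (∀ t ∈ L.filter (fun t => p t ≤ θ), 0 ≤ q t ∧ q t ≤ 1) ∧
      (∀ z, ∑ t ∈ L with p t ≤ θ, (if q t = z then y t - z else 0) = 0) ∧
      ∑ t ∈ L with p t ≤ θ, |p t - q t| ≤ 139 * √N := by
  set Γ := cumulative L p (fun t => (y t - p t) * Real.exp (p t)) with hΓ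
  -- This balances the rounding displacement `#L / n` against the imbalance of order `n`.
  set n := ⌈√N⌉₊ with hn
  have hs1 : 1 ≤ √N := Real.one_le_sqrt.2 hN1
  have hss : √N * √N = N := Real.mul_self_sqrt (by linarith)
  have hn1 : √N ≤ n := Nat.le_ceil _
  have hn2 : (n : ℝ) < √N + 1 := Nat.ceil_lt_add_one (Real.sqrt_nonneg _)
  have hn' : (0 : ℝ) < n := by linarith
  have hn0 : 0 < n := by exact_mod_cast hn'
  have hLn : (#L : ℝ) ≤ n * √N := by nlinarith
  have hI := integral_abs_cumulative_le (w := fun t => y t - p t) hp0 hp1 hN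
  have hF : ∀ u, 0 ≤ u → u ≤ 2 / 3 →
      |cumulative L p (fun t => (y t - p t) / (1 - p t)) u| ≤ 3 * |Γ u| + 12 * √N := by
    intro u hu0 hu1
    have := abs_cumulative_div_le (w := fun t => y t - p t) hp0 hu0 hu1
    linarith
  have hfilter : ∀ u, ∑ t ∈ L.filter (fun t => p t ≤ θ) with p t ≤ u, (y t - p t) / (1 - p t)
      = cumulative L p (fun t => (y t - p t) / (1 - p t)) (min u θ) := by
    intro u
    rw [cumulative, Finset.filter_filter]
    refine Finset.sum_congr (Finset.filter_congr fun t _ => ?_) fun _ _ => rfl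
    rw [le_min_iff, and_comm]
  have hriemann : ∑ j ∈ range n, |Γ ((j : ℝ) / n)| ≤ n * (5 * √N) := by
    refine (sum_abs_cumulative_le L p _ (M := 3) (fun t ht => ?_) hn0).trans ?_
    · have h1 : Real.exp (p t) ≤ 3 := by
        refine (Real.exp_le_exp.2 (hp1 t ht)).trans ?_
        linarith [Real.exp_one_lt_d9]
      have h2 : |y t - p t| ≤ 1 := by
        have := hp0 t ht
        have := hp1 t ht
        rcases hy t ht with h | h <;> rw [h, abs_le] <;> constructor <;> linarith
      rw [abs_mul, Real.abs_exp]
      nlinarith [Real.exp_pos (p t), abs_nonneg (y t - p t)]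
    · nlinarith
  -- `66 = 3 · 5 + 51`: the grid sum of `3|Γ|` contributes `15`, while `51 = 3 · 13 + 12` covers the
  -- grid points beyond `θ`, where the sum is frozen at its value at `θ`.
  obtain ⟨b, hb, hb1, hb2⟩ := exists_grid_assignment (L.filter fun t => p t ≤ θ) p y
    (fun t ht => hp0 t (Finset.mem_filter.1 ht).1)
    (fun t ht => (Finset.mem_filter.1 ht).2.trans hθ1)
    (fun t ht => hy t (Finset.mem_filter.1 ht).1) n hn0 (66 * √N) (by
      simp_rw [hfilter]
      have h1 : ∀ j ∈ range n,
          |cumulative L p (fun t => (y t - p t) / (1 - p t)) (min ((j : ℝ) / n) θ)|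
          ≤ 3 * |Γ ((j : ℝ) / n)| + 51 * √N := by
        intro j _
        refine (hF _ (le_min (by positivity) hθ0) ((min_le_right _ _).trans hθ1)).trans ?_
        rcases min_choice ((j : ℝ) / n) θ with h | h <;> rw [h]
        · linarith
        · linarith [abs_nonneg (Γ ((j : ℝ) / n))]
      refine (Finset.sum_le_sum h1).trans ?_
      rw [Finset.sum_add_distrib, ← Finset.mul_sum, Finset.sum_const, Finset.card_range,
        nsmul_eq_mul]
      linarith) (by
      have h1 := hF θ hθ0 hθ1
      rw [cumulative] at h1
      linarith)
  obtain ⟨q, hq, hcal, hdist⟩ := exists_calibrated_of_partition (L.filter fun t => p t ≤ θ) p y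
    (fun t ht => hy t (Finset.mem_filter.1 ht).1) n b hb (fun j => (j : ℝ) / n)
  refine ⟨q, hq, hcal, ?_⟩
  have hcard : (#{t ∈ L | p t ≤ θ} : ℝ) / n ≤ √N := by
    rw [div_le_iff₀ hn', mul_comm]
    refine le_trans ?_ hLn
    exact_mod_cast Finset.card_filter_le _ _
  -- Displacement at most `(1 + 66 + 1) √N` and imbalance at most `(2 + 66 + 3) √N`, in total `139
  -- √N`.
  rw [mul_div_assoc] at hb2
  linarith

/-- Forecasts with bounded Laplace-kernel energy are close to perfectly calibrated ones. -/
theorem exists_calibrated_of_energy_le {ι : Type*} (L : Finset ι) (p y : ι → ℝ)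
    (hp0 : ∀ t ∈ L, 0 ≤ p t) (hp1 : ∀ t ∈ L, p t ≤ 1) (hy : ∀ t ∈ L, y t = 0 ∨ y t = 1)
    {N : ℝ} (hN1 : 1 ≤ N) (hLN : #L ≤ N)
    (hN : ∑ t ∈ L, ∑ s ∈ L, Real.exp (-|p t - p s|) * (y t - p t) * (y s - p s) ≤ N) :
    ∃ q : ι → ℝ, (∀ t ∈ L, 0 ≤ q t ∧ q t ≤ 1) ∧
      (∀ z, ∑ t ∈ L, (if q t = z then y t - z else 0) = 0) ∧
      ∑ t ∈ L, |p t - q t| ≤ 278 * √N := by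
  set p' : ι → ℝ := fun t => 1 - p t with hp'
  set y' : ι → ℝ := fun t => 1 - y t with hy'
  have hp0' : ∀ t ∈ L, 0 ≤ p' t := fun t ht => sub_nonneg.2 (hp1 t ht)
  have hp1' : ∀ t ∈ L, p' t ≤ 1 := fun t ht => sub_le_self _ (hp0 t ht)
  have hyy' : ∀ t ∈ L, y' t = 0 ∨ y' t = 1 := fun t ht => by
    rcases hy t ht with h | h <;> simp [hy', h]
  have hN' : ∑ t ∈ L, ∑ s ∈ L, Real.exp (-|p' t - p' s|) * (y' t - p' t) * (y' s - p' s) ≤ N := by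
    refine le_trans (le_of_eq ?_) hN
    refine Finset.sum_congr rfl fun t _ => Finset.sum_congr rfl fun s _ => ?_
    have h1 : |p' t - p' s| = |p t - p s| := by
      rw [abs_sub_comm (p t)]
      congr 1
      simp only [hp']
      ring
    rw [h1]
    simp only [hp', hy']
    ring
  set Γ := cumulative L p (fun t => (y t - p t) * Real.exp (p t)) with hΓ
  set Γ' := cumulative L p' (fun t => (y' t - p' t) * Real.exp (p' t)) with hΓ'
  have hI := integral_abs_cumulative_le (w := fun t => y t - p t) hp0 hp1 hN
  have hI' := integral_abs_cumulative_le (w := fun t => y' t - p' t) hp0' hp1' hN'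
  have hs1 : 1 ≤ √N := Real.one_le_sqrt.2 hN1
  -- The two integrals add up to at most `4 √N`, so the mean over an interval of length `1/3` is at
  -- most `12 √N < 13 √N`. Avoiding the finitely many forecasts makes the reflected part exactly the
  -- complement.
  obtain ⟨θ, hθ0, hθ1, hθL, hθ⟩ : ∃ θ : ℝ, 1 / 3 ≤ θ ∧ θ ≤ 2 / 3 ∧ (∀ t ∈ L, p t ≠ θ) ∧
      |Γ θ| + |Γ' (1 - θ)| ≤ 13 * √N := by
    by_contra hcon
    push Not at hcon
    have hi1 : ∀ a b, IntervalIntegrable (fun u => |Γ u|) MeasureTheory.volume a b :=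
      fun a b => (intervalIntegrable_cumulative _ _ _ _ _).abs
    have hi2 : ∀ a b, IntervalIntegrable (fun u => |Γ' (1 - u)|) MeasureTheory.volume a b :=
      fun a b => (intervalIntegrable_of_bounded
        ((measurable_cumulative _ _ _).comp (measurable_const.sub measurable_id))
        (fun u => abs_cumulative_le _ _ _ _) a b).abs
    have hi : ∀ a b, IntervalIntegrable (fun u => |Γ u| + |Γ' (1 - u)|)
        MeasureTheory.volume a b := fun a b => (hi1 a b).add (hi2 a b)
    have h1 : ∫ _u in (1 / 3 : ℝ)..(2 / 3), 13 * √N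
        ≤ ∫ u in (1 / 3 : ℝ)..(2 / 3), (|Γ u| + |Γ' (1 - u)|) := by
      refine intervalIntegral.integral_mono_ae_restrict (by norm_num) intervalIntegrable_const
        (hi _ _) ?_
      have hfin : (p '' (L : Set ι)).Finite := L.finite_toSet.image p
      have hae : ∀ᵐ u : ℝ, u ∉ p '' (L : Set ι) :=
        MeasureTheory.measure_eq_zero_iff_ae_notMem.1 (hfin.measure_zero _)
      rw [Filter.EventuallyLE, MeasureTheory.ae_restrict_iff' measurableSet_Icc]
      filter_upwards [hae] with u hu hmem
      exact (hcon u hmem.1 hmem.2 fun t ht h => hu ⟨t, ht, h⟩).le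
    have h2 : ∫ u in (1 / 3 : ℝ)..(2 / 3), (|Γ u| + |Γ' (1 - u)|)
        ≤ ∫ u in (0 : ℝ)..1, (|Γ u| + |Γ' (1 - u)|) :=
      intervalIntegral.integral_mono_interval (by norm_num) (by norm_num) (by norm_num)
        (Filter.Eventually.of_forall fun u => by positivity) (hi _ _)
    have h3 : ∫ u in (0 : ℝ)..1, (|Γ u| + |Γ' (1 - u)|)
        = (∫ u in (0 : ℝ)..1, |Γ u|) + ∫ u in (0 : ℝ)..1, |Γ' u| := by
      rw [intervalIntegral.integral_add (hi1 _ _) (hi2 _ _),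
        intervalIntegral.integral_comp_sub_left (fun u => |Γ' u|) 1, sub_self, sub_zero]
    rw [intervalIntegral.integral_const, smul_eq_mul] at h1
    rw [← hΓ] at hI
    rw [← hΓ'] at hI'
    norm_num at h1
    linarith
  obtain ⟨q₁, hq₁, hcal₁, hdist₁⟩ := exists_calibrated_below L p y hp0 hp1 hy hN1 hLN hN
    (θ := θ) (by linarith) hθ1 (by linarith [abs_nonneg (Γ' (1 - θ))])
  obtain ⟨q₂, hq₂, hcal₂, hdist₂⟩ := exists_calibrated_below L p' y' hp0' hp1' hyy' hN1 hLN hN'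
    (θ := 1 - θ) (by linarith) (by linarith) (by linarith [abs_nonneg (Γ θ)])
  have hR : L.filter (fun t => p' t ≤ 1 - θ) = L.filter (fun t => ¬ p t ≤ θ) := by
    refine Finset.filter_congr fun t ht => ?_
    have := hθL t ht
    simp only [hp', not_le]
    exact ⟨fun h => lt_of_le_of_ne (by linarith) this.symm, fun h => by linarith⟩
  rw [hR] at hq₂ hdist₂
  simp_rw [hR] at hcal₂
  refine ⟨fun t => if p t ≤ θ then q₁ t else 1 - q₂ t, fun t ht => ?_, fun z => ?_, ?_⟩
  · by_cases h : p t ≤ θ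
    · simp only [h, if_true]
      exact hq₁ t (Finset.mem_filter.2 ⟨ht, h⟩)
    · simp only [h, if_false]
      have := hq₂ t (Finset.mem_filter.2 ⟨ht, h⟩)
      constructor <;> linarith
  · rw [← Finset.sum_filter_add_sum_filter_not L (fun t => p t ≤ θ)]
    have h1 : ∑ t ∈ L with p t ≤ θ, (if (if p t ≤ θ then q₁ t else 1 - q₂ t) = z
        then y t - z else 0) = 0 := by
      refine Eq.trans (Finset.sum_congr rfl fun t ht => ?_) (hcal₁ z)
      rw [if_pos (Finset.mem_filter.1 ht).2]
    have h2 : ∑ t ∈ L with ¬ p t ≤ θ, (if (if p t ≤ θ then q₁ t else 1 - q₂ t) = z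
        then y t - z else 0) = 0 := by
      rw [← neg_eq_zero, ← Finset.sum_neg_distrib]
      refine Eq.trans (Finset.sum_congr rfl fun t ht => ?_) (hcal₂ (1 - z))
      rw [if_neg (Finset.mem_filter.1 ht).2]
      by_cases h : q₂ t = 1 - z
      · rw [if_pos h, if_pos (by linarith)]
        simp only [hy']
        ring
      · rw [if_neg h, if_neg (fun h' => h (by linarith)), neg_zero]
    rw [h1, h2, add_zero]
  · rw [← Finset.sum_filter_add_sum_filter_not L (fun t => p t ≤ θ)]
    have h1 : ∑ t ∈ L with p t ≤ θ, |p t - (if p t ≤ θ then q₁ t else 1 - q₂ t)|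
        = ∑ t ∈ L with p t ≤ θ, |p t - q₁ t| :=
      Finset.sum_congr rfl fun t ht => by rw [if_pos (Finset.mem_filter.1 ht).2]
    have h2 : ∑ t ∈ L with ¬ p t ≤ θ, |p t - (if p t ≤ θ then q₁ t else 1 - q₂ t)|
        = ∑ t ∈ L with ¬ p t ≤ θ, |p' t - q₂ t| := by
      refine Finset.sum_congr rfl fun t ht => ?_
      rw [if_neg (Finset.mem_filter.1 ht).2, abs_sub_comm (p' t)]
      congr 1
      simp only [hp']
      ring
    rw [h1, h2]
    linarith

theorem theorem5p3 :
    ∃ K : ℝ, 0 < K ∧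
      ∀ (X : Type*) (C : Set (Set X)) (m : ℕ), (∀ x : X, {c ∈ C | x ∈ c}.encard ≤ m) →
        (∀ z z' : ℝ × X, |AnyKernel.kMC C z z'| ≤ m) ∧
        ∀ (T : ℕ) (x : Fin T → X) (p : Fin T → unitInterval) (y : Fin T → ℝ),
          AnyKernel.IsTranscript (AnyKernel.kMCUnit C) x p y →
            AnyKernel.dMCE x y C p ≤ ENNReal.ofReal (K * √((m : ℝ) * T)) := by
  classical
  refine ⟨278, by norm_num, fun X C m hm => ⟨AnyKernel.abs_kMC_le hm, fun T x p y h => ?_⟩⟩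
  refine iSup₂_le fun c hc => ?_
  -- On a group that is never visited `p` itself is calibrated; a visited group forces `1 ≤ m` and
  -- `1 ≤ T`, hence `1 ≤ N`.
  by_cases hempty : ∀ t, x t ∉ c
  · refine iInf₂_le_of_le p (fun v => ?_) (by simp)
    simp [hempty]
  push Not at hempty
  obtain ⟨t₀, ht₀⟩ := hempty
  set L : Finset (Fin T) := Finset.univ.filter fun t => x t ∈ c with hL
  have hT : (1 : ℝ) ≤ T := by exact_mod_cast t₀.pos
  have hm1 : (1 : ℝ) ≤ m := by
    have h1 : 1 ≤ {c ∈ C | x t₀ ∈ c}.encard := Set.one_le_encard_iff_nonempty.2 ⟨c, hc, ht₀⟩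
    exact_mod_cast h1.trans (hm (x t₀))
  have hcard : (#L : ℝ) ≤ m * T := by
    have h1 : (#L : ℝ) ≤ T := by
      exact_mod_cast (Finset.card_filter_le _ _).trans (by simp)
    nlinarith
  obtain ⟨q, hq, hcal, hdist⟩ := exists_calibrated_of_energy_le L (fun t => (p t : ℝ)) y
    (fun t _ => (p t).2.1) (fun t _ => (p t).2.2) (fun t _ => (h t).1) (N := m * T)
    (by nlinarith) hcard
    (AnyKernel.energy_group_le hm x (fun t => (p t : ℝ)) (fun t => y t - p t) _
      (fun L => energy_nonneg (fun t _ => (p t).2.1) (fun t _ => (p t).2.2))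
      (h.sum_sum_le hm) c hc L (by simp [hL]))
  have hmem : ∀ {t}, x t ∈ c → t ∈ L := fun ht => by simpa [hL] using ht
  refine iInf₂_le_of_le
    (fun t => if ht : x t ∈ c then ⟨q t, hq t (hmem ht)⟩ else p t) (fun v => ?_) ?_
  · refine Eq.trans ?_ (hcal v)
    rw [hL, Finset.sum_filter]
    refine Finset.sum_congr rfl fun t _ => ?_
    by_cases ht : x t ∈ c
    · simp [ht, Set.indicator_apply, Subtype.ext_iff]
    · simp [ht]
  · rw [← ENNReal.ofReal_sum_of_nonneg fun _ _ => abs_nonneg _]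
    refine ENNReal.ofReal_le_ofReal (le_trans (le_of_eq ?_) hdist)
    rw [hL, Finset.sum_filter]
    refine Finset.sum_congr rfl fun t _ => ?_
    by_cases ht : x t ∈ c <;> simp [ht]
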